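/- Let $d$ be a natural number. For $z=(x,\omega)\in\mathbb{R}^{2d}$ let $\pi(z)$ be the time-frequency shift $\pi(z)\psi(t)=e^{2\pi i\omega\cdot t}\psi(t-x)$ on $L^2(\mathbb{R}^d)$, and for a bounded operator $A$ on $L^2(\mathbb{R}^d)$ put $\alpha_z(A)=\pi(z)A\pi(z)^*$ and $\check A=PAP$, where $P\psi(t)=\psi(-t)$. Let $S$ be a positive trace class operator on $L^2(\mathbb{R}^d)$ with $\mathrm{tr}(S)=1$. For a bounded operator $T$ define the function $S\ast T(z)=\mathrm{tr}(S\,\alpha_z(\check T))$ on $\mathbb{R}^{2d}$, and for $f\in L^\infty(\mathbb{R}^{2d})$ define the operator $f\ast S=\int_{\mathbb{R}^{2d}}f(z)\,\alpha_z(S)\,dz$ as a weak integral. The spectrum of a function in $L^\infty$ is its essential range. "Positive" means $\ge 0$, and traces of positive operators and integrals of positive functions take values in $[0,\infty]$. 1. Let $T$ be a bounded self-adjoint operator. Then $S\ast T$ is real-valued, and if $\Phi$ is a positive, convex and continuous real function on a convex set $D\subseteq\mathbb{R}$ containing the spectra of $T$ and of $S\ast T$, then $$\int_{\mathbb{R}^{2d}}\Phi\circ(S\ast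 T)(z)\,dz\le\mathrm{tr}(\Phi(T)).$$ 2. Let $f\in L^\infty(\mathbb{R}^{2d})$ be real-valued. Then the weak integral $f\ast S$ exists and is a bounded self-adjoint operator, and if $\Phi$ is a positive, convex and continuous real function on a convex set $D\subseteq\mathbb{R}$ containing the spectra of $f$ and of $f\ast S$, then $$\mathrm{tr}(\Phi(f\ast S))\le\int_{\mathbb{R}^{2d}}\Phi\circ f(z)\,dz.$$ 3. In particular, let $A$ be a bounded self-adjoint operator, $\beta\in\mathbb{R}$, and let $\sigma,\sigma'$ be positive trace class operators of trace $1$. Then $A_{\sigma'}(z)=\mathrm{tr}(A\,\alpha_z(\sigma'))$ is real-valued and $$\int_{\mathbb{R}^{2d}}e^{-\beta A_{\sigma'}(z)}\,dz\le\mathrm{tr}(e^{-\beta A}),$$ and if $A=f\ast\sigma^*$ for a real-valued $f=A_{-\sigma}\in L^\infty(\mathbb{R}^{2d})$, then $$\mathrm{tr}(e^{-\beta A})\le\int_{\mathbb{R}^{2d}}e^{-\beta A_{-\sigma}(z)}\,dz.$$ -/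

import Mathlib

open MeasureTheory
open scoped ENNReal InnerProductSpace

noncomputable section

namespace BerezinLieb

/-! ### Functional calculus and traces of operators on a Hilbert space -/

section Operators

variable {H : Type*} [NormedAddCommGroup H] [InnerProductSpace ℂ H] [CompleteSpace H]

variable (H) in
/-- The index set of a fixed orthonormal basis of `H`. -/
def basisIndex : Set H := (exists_hilbertBasis ℂ H).choose

variable (H) in
/-- A fixed orthonormal basis of `H`. The traces below do not depend on its choice. -/
def basis : HilbertBasis (basisIndex H) ℂ H :=
  (exists_hilbertBasis ℂ H).choose_spec.choose

/-- The real spectrum of `A`, which is the whole spectrum if `A` is self-adjoint. -/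
def realSpectrum (A : H →L[ℂ] H) : Set ℝ := spectrum ℝ A

/-- The operator `Φ(A)` given by the continuous functional calculus, for a self-adjoint operator
`A` and a real function `Φ` that is continuous on the spectrum of `A`. -/
def applyFun (Φ : ℝ → ℝ) (A : H →L[ℂ] H) : H →L[ℂ] H := cfc Φ A

/-- The trace `∑ᵢ ⟨A eᵢ, eᵢ⟩ ∈ [0, ∞]` of a positive bounded operator `A`. -/
def posTrace (A : H →L[ℂ] H) : ℝ≥0∞ :=
  ∑' i, ENNReal.ofReal (⟪basis H i, A (basis H i)⟫_ℂ).re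

/-- `A` is a trace class operator: `tr |A| < ∞`, where `|A| = (A* A)^(1/2)`. -/
def IsTraceClass (A : H →L[ℂ] H) : Prop :=
  posTrace (CFC.abs A) < ∞

/-- The trace `∑ᵢ ⟨A eᵢ, eᵢ⟩ ∈ ℂ` of a trace class operator `A`. -/
def trace (A : H →L[ℂ] H) : ℂ :=
  ∑' i, ⟪basis H i, A (basis H i)⟫_ℂ

end Operators

/-! ### Essential range -/

/-- The essential range of a real function `g`, that is, its spectrum as an element of
the algebra `L^∞`. -/
def essRange {X : Type*} [MeasureSpace X] (g : X → ℝ) : Set ℝ :=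
  {y | ∀ ε > 0, volume {x | |g x - y| < ε} ≠ 0}

/-! ### Time-frequency shifts on `L²(ℝᵈ)` -/

/-- Euclidean space `ℝᵈ`. -/
abbrev Space (d : ℕ) : Type := EuclideanSpace ℝ (Fin d)

/-- Phase space `ℝ²ᵈ`, with elements `z = (x, ω)`, and with Lebesgue measure as `volume`. -/
abbrev Phase (d : ℕ) : Type := Space d × Space d

/-- The complex Hilbert space `L²(ℝᵈ)`. -/
abbrev L2 (d : ℕ) : Type := Lp ℂ 2 (volume : Measure (Space d))

/-- The translation `T_x ψ (t) = ψ (t - x)`. -/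
def translation {d : ℕ} (x : Space d) : L2 d →L[ℂ] L2 d :=
  (Lp.compMeasurePreservingₗᵢ ℂ (fun t : Space d => t - x)
    (measurePreserving_sub_right volume x)).toContinuousLinearMap

/-- The character `t ↦ exp (2 π i ω · t)`. -/
def character {d : ℕ} (ω : Space d) (t : Space d) : ℂ :=
  Complex.exp (2 * Real.pi * Complex.I * (⟪ω, t⟫_ℝ : ℝ))

theorem memLp_character {d : ℕ} (ω : Space d) :
    MemLp (character ω) ∞ (volume : Measure (Space d)) := by
  refine memLp_top_of_bound (C := 1) ?_ (Filter.Eventually.of_forall fun t => ?_)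
  · refine Continuous.aestronglyMeasurable ?_
    unfold character
    fun_prop
  · rw [character, show 2 * (Real.pi : ℂ) * Complex.I * ((⟪ω, t⟫_ℝ : ℝ) : ℂ)
      = ((2 * Real.pi * ⟪ω, t⟫_ℝ : ℝ) : ℂ) * Complex.I by push_cast; ring]
    exact (Complex.norm_exp_ofReal_mul_I _).le

/-- The modulation `M_ω ψ (t) = exp (2 π i ω · t) ψ (t)`. -/
def modulation {d : ℕ} (ω : Space d) : L2 d →L[ℂ] L2 d :=
  (ContinuousLinearMap.mul ℂ ℂ).holderL volume ∞ 2 2 (memLp_character ω).toLp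

/-- The time-frequency shift `π(z) = M_ω T_x` for `z = (x, ω)`. -/
def timeFreqShift {d : ℕ} (z : Phase d) : L2 d →L[ℂ] L2 d :=
  modulation z.2 ∘L translation z.1

/-- The parity operator `P ψ (t) = ψ (-t)`. -/
def parity (d : ℕ) : L2 d →L[ℂ] L2 d :=
  (Lp.compMeasurePreservingₗᵢ ℂ (fun t : Space d => -t)
    (Measure.measurePreserving_neg volume)).toContinuousLinearMap

theorem timeFreqShift_apply_ae {d : ℕ} (z : Phase d) (ψ : L2 d) :
    timeFreqShift z ψ =ᵐ[volume] fun t => character z.2 t * ψ (t - z.1) := by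
  have h1 := (ContinuousLinearMap.mul ℂ ℂ).coeFn_holder (r := 2)
    (memLp_character z.2).toLp (translation z.1 ψ)
  have h2 := (memLp_character z.2).coeFn_toLp
  have h3 := Lp.coeFn_compMeasurePreserving ψ (measurePreserving_sub_right volume z.1)
  filter_upwards [h1, h2, h3] with t h1 h2 h3
  refine h1.trans ?_
  rw [h2, ContinuousLinearMap.mul_apply']
  exact congrArg _ h3

theorem parity_apply_ae {d : ℕ} (ψ : L2 d) :
    parity d ψ =ᵐ[volume] fun t => ψ (-t) :=
  Lp.coeFn_compMeasurePreserving ψ (Measure.measurePreserving_neg volume)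

/-! ### Convolutions of operators and functions -/

/-- The shift `α_z(A) = π(z) A π(z)*` of an operator `A`. -/
def shift {d : ℕ} (z : Phase d) (A : L2 d →L[ℂ] L2 d) : L2 d →L[ℂ] L2 d :=
  timeFreqShift z ∘L A ∘L (timeFreqShift z).adjoint

/-- The operator `Ǎ = P A P`. -/
def check {d : ℕ} (A : L2 d →L[ℂ] L2 d) : L2 d →L[ℂ] L2 d :=
  parity d ∘L A ∘L parity d

/-- The convolution `S ∗ T (z) = tr (S α_z(Ť))` of two operators, one of them trace class. -/
def opConv {d : ℕ} (S T : L2 d →L[ℂ] L2 d) (z : Phase d) : ℂ :=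
  trace (S ∘L shift z (check T))

/-- `A = ∫ f(z) α_z(S) dz` as a weak integral. -/
def IsFunConv {d : ℕ} (f : Phase d → ℂ) (S A : L2 d →L[ℂ] L2 d) : Prop :=
  ∀ ψ η : L2 d, Integrable (fun z => f z * ⟪η, shift z S ψ⟫_ℂ) ∧
    ⟪η, A ψ⟫_ℂ = ∫ z, f z * ⟪η, shift z S ψ⟫_ℂ

open Classical in
/-- The convolution `f ∗ S = ∫ f(z) α_z(S) dz` of a function and an operator: the unique bounded
operator given by this weak integral (and `0` if there is none). -/
def funConv {d : ℕ} (f : Phase d → ℂ) (S : L2 d →L[ℂ] L2 d) : L2 d →L[ℂ] L2 d :=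
  if h : ∃ A, IsFunConv f S A then h.choose else 0

/-- The generalized Husimi representation `A_σ(z) = tr (A α_z(σ))` of an operator `A`. -/
def husimi {d : ℕ} (σ A : L2 d →L[ℂ] L2 d) (z : Phase d) : ℂ :=
  trace (A ∘L shift z σ)

/-- A positive trace class operator of trace one. -/
structure IsState {d : ℕ} (S : L2 d →L[ℂ] L2 d) : Prop where
  isPositive : S.IsPositive
  isTraceClass : IsTraceClass S
  trace_eq_one : trace S = 1

end BerezinLieb

end

open BerezinLieb

/-! ### Approximation of convex functions by sums of hinge functions -/

namespace BerezinLieb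

/-! Write the state as `S = R²` with `R` self-adjoint, Hilbert–Schmidt and `∑ ‖R eⱼ‖² = 1`. By
Moyal's identity the vectors `vⱼ(z) = π(z) R eⱼ` resolve the identity (`IsResolution`): `∑ⱼ
|vⱼ(z)⟩⟨vⱼ(z)|` has trace one for every `z` and integrates to the identity over phase space. So do
the vectors `P π(z)* R eⱼ`. In these terms `opConv` and `husimi` are averages `∑ⱼ ⟨vⱼ, T vⱼ⟩`, and
`f ∗ S` is `∫ f(z) ∑ⱼ |vⱼ(z)⟩⟨vⱼ(z)| dz`. The theorem is thus a pair of Berezin–Lieb inequalities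
for a resolution of the identity.

Lower symbols: Jensen's inequality `Φ(∑ ⟨vⱼ, T vⱼ⟩) ≤ ∑ ⟨vⱼ, Φ(T) vⱼ⟩` holds at each `z`
(`le_tsum_re_inner_cfc`), and the right side integrates to `tr Φ(T)`
(`IsResolution.lintegral_tsum_inner`).

Upper symbols: Jensen in an eigenbasis of `A` is not an option, since `A` may have continuous
spectrum. Instead `Φ` is approximated on a compact interval by sums `Ψ` of hinges `(a t + b)₊`
(`exists_isHingeSum`). For one hinge, compressing `a A + b` to the support of its positive part
yields `tr (a A + b)₊ ≤ ∫ (a f + b)₊` (`IsResolution.posTrace_cfc_hinge_le`), and both sides are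
additive in the hinge. Phase space and the trace have infinite total mass, so a uniform error must
not be integrated: `Ψ ≤ Φ` makes the integral side free of error, and on the trace side only finite
partial sums are compared. -/

/-- Finite sums of functions of the form `t ↦ max (a t + b) 0`. -/
inductive IsHingeSum : (ℝ → ℝ) → Prop
  | hinge (a b : ℝ) : IsHingeSum (fun t => max (a * t + b) 0)
  | add {f g : ℝ → ℝ} : IsHingeSum f → IsHingeSum g → IsHingeSum (fun t => f t + g t)

theorem IsHingeSum.continuous {f : ℝ → ℝ} (hf : IsHingeSum f) : Continuous f := by
  induction hf with
  | hinge a b => fun_prop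
  | add _ _ h1 h2 => exact h1.add h2

theorem IsHingeSum.nonneg {f : ℝ → ℝ} (hf : IsHingeSum f) (t : ℝ) : 0 ≤ f t := by
  induction hf with
  | hinge a b => exact le_max_right _ _
  | add _ _ h1 h2 => exact add_nonneg h1 h2

theorem IsHingeSum.comp_neg {f : ℝ → ℝ} (hf : IsHingeSum f) : IsHingeSum fun t => f (-t) := by
  induction hf with
  | hinge a b => simpa using IsHingeSum.hinge (-a) b
  | add _ _ h1 h2 => exact h1.add h2

/-- A monotone convex function on `[c, c + n h]` which varies by at most `ε / 2` on the intervals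
`[c + k h, c + (k + 1) h]` is approximated from below by hinge sums, with an affine formula beyond
the last node. -/
theorem exists_isHingeSum_of_step {g : ℝ → ℝ} {c h ε : ℝ} (hh : 0 < h) (hg0 : g c = 0) (n : ℕ)
    (hg : ConvexOn ℝ (Set.Icc c (c + n * h)) g) (hmono : MonotoneOn g (Set.Icc c (c + n * h)))
    (hvar : ∀ s ∈ Set.Icc c (c + n * h), ∀ t ∈ Set.Icc c (c + n * h), |s - t| ≤ 2 * h →
      |g s - g t| ≤ ε) (k : ℕ) (hk : k + 1 ≤ n) :
    ∃ Ψ, IsHingeSum Ψ ∧ (∀ t ≤ c, Ψ t = 0) ∧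
      (∀ t ∈ Set.Icc c (c + (k + 1) * h), Ψ t ≤ g t ∧ g t ≤ Ψ t + ε) ∧
      ∀ t, c + (k + 1) * h ≤ t →
        Ψ t = g (c + k * h)
          + (g (c + (k + 1) * h) - g (c + k * h)) / h * (t - (c + (k + 1) * h)) := by
  have node : ∀ j : ℕ, j ≤ n → c + j * h ∈ Set.Icc c (c + n * h) := fun j hj => by
    have : (j : ℝ) ≤ n := by exact_mod_cast hj
    exact ⟨by nlinarith [(Nat.cast_nonneg j : (0 : ℝ) ≤ j)], by nlinarith⟩
  induction k with
  | zero =>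
    have h0 := node 0 (by omega)
    have h1 := node 1 hk
    simp only [Nat.cast_zero, zero_mul, add_zero, Nat.cast_one, one_mul, zero_add] at h0 h1 ⊢
    have hs : 0 ≤ g (c + h) / h := by
      have := hmono h0 h1 (by linarith)
      rw [hg0] at this
      positivity
    -- `Ψ` is the piecewise linear interpolant of `g` delayed by one mesh width, `Ψ(t) = I(t - h)`;
    -- the first kink is therefore at `c + h`. The delay turns an interpolant lying above the convex
    -- `g` into a minorant, because `g` is increasing.
    refine ⟨_, .hinge (g (c + h) / h) (-(g (c + h) / h * (c + h))), fun t ht => ?_, fun t ht => ?_,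
      fun t ht => ?_⟩
    · exact max_eq_right (by nlinarith)
    · have ht' : t ∈ Set.Icc c (c + n * h) := ⟨ht.1, ht.2.trans h1.2⟩
      rw [max_eq_right (by nlinarith [ht.2])]
      have := hmono h0 ht' ht.1
      have h2 := hvar t ht' c h0 (by rw [abs_of_nonneg] <;> linarith [ht.1, ht.2])
      rw [hg0, sub_zero] at h2
      exact ⟨by linarith, by linarith [le_abs_self (g t)]⟩
    · rw [max_eq_left (by nlinarith), hg0]
      ring
  | succ k ih =>
    obtain ⟨Ψ, hΨ, hΨ0, hb, hf⟩ := ih (by omega)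
    have n0 := node k (by omega)
    have n1 := node (k + 1) (by omega)
    have n2 := node (k + 1 + 1) hk
    push_cast at n0 n1 n2 ⊢
    set x0 := c + k * h with hx0
    set x1 := c + (k + 1) * h with hx1
    set x2 := c + (k + 1 + 1) * h with hx2
    have e1 : x1 = x0 + h := by rw [hx0, hx1]; ring
    have e2 : x2 = x1 + h := by rw [hx2, hx1]; ring
    have hconv : 2 * g x1 ≤ g x0 + g x2 := by
      have := hg.2 n0 n2 (show (0 : ℝ) ≤ 1 / 2 by norm_num) (show (0 : ℝ) ≤ 1 / 2 by norm_num)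
        (by norm_num)
      have e : (1 / 2 : ℝ) • x0 + (1 / 2 : ℝ) • x2 = x1 := by
        simp only [smul_eq_mul]; rw [e2, e1]; ring
      rw [e] at this
      simp only [smul_eq_mul] at this
      linarith
    -- The jump of the slope at the new kink `x2`; it is nonnegative by midpoint convexity.
    set a := (g x2 - g x1) / h - (g x1 - g x0) / h with ha
    have ha0 : 0 ≤ a := by
      rw [ha, ← sub_div]
      exact div_nonneg (by linarith) hh.le
    refine ⟨_, hΨ.add (.hinge a (-(a * x2))), fun t ht => ?_, fun t ht => ?_, fun t ht => ?_⟩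
    · have : c ≤ x2 := n2.1
      rw [hΨ0 t ht, max_eq_right (by nlinarith), add_zero]
    · rw [max_eq_right (by nlinarith [ht.2]), add_zero]
      rcases le_total t x1 with h' | h'
      · exact hb t ⟨ht.1, h'⟩
      · rw [hf t h']
        have ht' : t ∈ Set.Icc c (c + n * h) := ⟨ht.1, ht.2.trans n2.2⟩
        have m1 := hmono n0 n1 (by linarith)
        have m2 := hmono n1 ht' h'
        have hs : 0 ≤ (g x1 - g x0) / h := div_nonneg (by linarith) hh.le
        have hs' : (g x1 - g x0) / h * h = g x1 - g x0 := div_mul_cancel₀ _ hh.ne'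
        -- On `[x1, x2]` the delayed interpolant is at least `g x0`, so `g` is compared at points up
        -- to `2 h` apart.
        have h3 := hvar t ht' x0 n0 (by rw [abs_of_nonneg] <;> linarith [ht.2])
        have h4 := le_abs_self (g t - g x0)
        have h5 : 0 ≤ (g x1 - g x0) / h * (t - x1) := mul_nonneg hs (by linarith)
        have h6 : (g x1 - g x0) / h * (t - x1) ≤ (g x1 - g x0) / h * h :=
          mul_le_mul_of_nonneg_left (by linarith [ht.2]) hs
        exact ⟨by linarith, by linarith⟩
    · rw [max_eq_left (by nlinarith), hf t (by linarith), ha]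
      have : (g x1 - g x0) / h * h = g x1 - g x0 := div_mul_cancel₀ _ hh.ne'
      have e3 : t - x1 = (t - x2) + h := by rw [e2]; ring
      rw [e3, mul_add, this]
      ring

/-- Uniform continuity supplies a mesh fine enough for the step construction. Vanishing to the left
of `c` is kept in the conclusion so that an increasing and a reflected decreasing branch can later
be added without interfering. -/
theorem exists_isHingeSum_of_monotoneOn {g : ℝ → ℝ} {c M ε : ℝ} (hcM : c ≤ M) (hε : 0 < ε)
    (hg0 : g c = 0) (hg : ConvexOn ℝ (Set.Icc c M) g) (hmono : MonotoneOn g (Set.Icc c M))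
    (hcont : ContinuousOn g (Set.Icc c M)) :
    ∃ Ψ, IsHingeSum Ψ ∧ (∀ t ≤ c, Ψ t = 0) ∧
      ∀ t ∈ Set.Icc c M, Ψ t ≤ g t ∧ g t ≤ Ψ t + ε := by
  rcases hcM.eq_or_lt with rfl | hlt
  · refine ⟨_, .hinge 0 0, fun t _ => by simp, fun t ht => ?_⟩
    obtain rfl : t = c := by simpa using ht
    simp [hg0, hε.le]
  have huc := isCompact_Icc.uniformContinuousOn_of_continuous hcont
  obtain ⟨δ, hδ, huc⟩ := Metric.uniformContinuousOn_iff.1 huc ε hε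
  -- This choice makes twice the mesh width `(M - c) / n` smaller than `δ`. The construction is then
  -- run up to `k = n - 1`, whose last node is `M`.
  obtain ⟨n, hn⟩ := exists_nat_gt (2 * (M - c) / δ)
  have hn0 : (0 : ℝ) < n := lt_of_le_of_lt (by have := sub_pos.2 hlt; positivity) hn
  have hh : 0 < (M - c) / n := div_pos (sub_pos.2 hlt) hn0
  have hM : c + n * ((M - c) / n) = M := by field_simp; ring
  have hn1 : 1 ≤ n := Nat.one_le_iff_ne_zero.2 (by rintro rfl; simp at hn0)
  obtain ⟨Ψ, hΨ, h0, hb, -⟩ := exists_isHingeSum_of_step (ε := ε) hh hg0 n (by rwa [hM])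
    (by rwa [hM]) (by
      rw [hM]
      intro s hs t ht hst
      refine (huc s hs t ht (lt_of_le_of_lt hst ?_)).le
      rw [div_lt_iff₀ hδ] at hn
      rw [← mul_div_assoc, div_lt_iff₀ hn0]
      linarith) (n - 1) (by omega)
  refine ⟨Ψ, hΨ, h0, ?_⟩
  have : ((n - 1 : ℕ) : ℝ) + 1 = n := by rw [Nat.cast_sub hn1]; simp
  rwa [this, hM] at hb

/-- A nonnegative continuous convex function on a compact interval is approximated uniformly and
from below by hinge sums. -/
theorem exists_isHingeSum {Φ : ℝ → ℝ} {m M ε : ℝ} (hmM : m ≤ M) (hε : 0 < ε)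
    (hΦ : ConvexOn ℝ (Set.Icc m M) Φ) (hcont : ContinuousOn Φ (Set.Icc m M))
    (hpos : ∀ t ∈ Set.Icc m M, 0 ≤ Φ t) :
    ∃ Ψ, IsHingeSum Ψ ∧ ∀ t ∈ Set.Icc m M, Ψ t ≤ Φ t ∧ Φ t ≤ Ψ t + ε := by
  obtain ⟨c, hc, hmin⟩ := isCompact_Icc.exists_isMinOn (Set.nonempty_Icc.2 hmM) hcont
  have hmin : ∀ t ∈ Set.Icc m M, Φ c ≤ Φ t := fun t ht => hmin ht
  have sub1 : Set.Icc c M ⊆ Set.Icc m M := Set.Icc_subset_Icc_left hc.1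
  have maps : Set.MapsTo (fun t : ℝ => -t) (Set.Icc (-c) (-m)) (Set.Icc m M) := fun t ht =>
    ⟨by linarith [ht.2], by linarith [ht.1, hc.2]⟩
  obtain ⟨R, hR, hR0, hRb⟩ := exists_isHingeSum_of_monotoneOn (g := fun t => Φ t + -Φ c)
    hc.2 hε (by simp) ((hΦ.subset sub1 (convex_Icc _ _)).add_const _)
    (fun s hs t ht hst => by
      have := hΦ.le_max_of_mem_Icc hc (sub1 ht) ⟨hs.1, hst⟩
      rw [max_eq_right (hmin t (sub1 ht))] at this
      linarith)
    ((hcont.mono sub1).add continuousOn_const)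
  obtain ⟨L, hL, hL0, hLb⟩ := exists_isHingeSum_of_monotoneOn (g := fun t => Φ (-t) + -Φ c)
    (neg_le_neg hc.1) hε (by simp)
    (ConvexOn.add_const ⟨convex_Icc _ _, fun x hx y hy a b ha hb hab => by
      have := hΦ.2 (maps hx) (maps hy) ha hb hab
      rwa [smul_neg, smul_neg, ← neg_add] at this⟩ _)
    (fun s hs t ht hst => by
      have := hΦ.le_max_of_mem_Icc (maps ht) hc (z := -s) ⟨by linarith, by linarith [hs.1]⟩
      rw [max_eq_left (hmin _ (maps ht))] at this
      linarith)
    ((hcont.comp continuousOn_neg maps).add continuousOn_const)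
  -- The minimum value `Φ c ≥ 0` is a hinge of slope zero; the branches on the two sides of the
  -- minimiser `c` are added to it.
  refine ⟨_, (IsHingeSum.hinge 0 (Φ c)).add (hR.add hL.comp_neg), fun t ht => ?_⟩
  rw [zero_mul, zero_add, max_eq_left (hpos c hc)]
  rcases le_total c t with h | h
  · rw [hL0 (-t) (by linarith)]
    have := hRb t ⟨h, ht.2⟩
    constructor <;> linarith
  · rw [hR0 t h]
    have := hLb (-t) ⟨by linarith, by linarith [ht.1]⟩
    rw [neg_neg] at this
    constructor <;> linarith

end BerezinLieb

/-! ### Hilbert space preliminaries -/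

namespace BerezinLieb

section Hilbert

variable {H : Type*} [NormedAddCommGroup H] [InnerProductSpace ℂ H]

theorem ofReal_norm_sq {E : Type*} [SeminormedAddCommGroup E] (x : E) :
    ENNReal.ofReal (‖x‖ ^ 2) = ‖x‖ₑ ^ 2 := by
  rw [ENNReal.ofReal_pow (norm_nonneg x), ofReal_norm]

theorem enorm_inner_symm (x y : H) : ‖⟪x, y⟫_ℂ‖ₑ = ‖⟪y, x⟫_ℂ‖ₑ := by
  rw [← ofReal_norm, ← ofReal_norm, norm_inner_symm]

theorem hasSum_norm_inner_sq {ι : Type*} (b : HilbertBasis ι ℂ H) (x : H) :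
    HasSum (fun i => ‖⟪b i, x⟫_ℂ‖ ^ 2) (‖x‖ ^ 2) := by
  rw [← Complex.hasSum_ofReal]
  have := b.hasSum_inner_mul_inner x x
  rw [inner_self_eq_norm_sq_to_K] at this
  convert! this using 1
  · ext i
    rw [← inner_conj_symm x (b i), Complex.conj_mul']
    push_cast
    rfl
  · push_cast
    rfl

/-- Parseval's identity in `[0, ∞]`. -/
theorem tsum_enorm_inner_sq {ι : Type*} (b : HilbertBasis ι ℂ H) (x : H) :
    ∑' i, ‖⟪b i, x⟫_ℂ‖ₑ ^ 2 = ‖x‖ₑ ^ 2 := by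
  rw [← ofReal_norm_sq, ← (hasSum_norm_inner_sq b x).tsum_eq,
    ENNReal.ofReal_tsum_of_nonneg (fun _ => by positivity) (hasSum_norm_inner_sq b x).summable]
  simp_rw [ofReal_norm_sq]

theorem hasSum_norm_sq_of_tsum_enorm_sq {ι E : Type*} [SeminormedAddCommGroup E] {x : ι → E}
    {c : ℝ} (hc : 0 ≤ c) (hx : ∑' j, ‖x j‖ₑ ^ 2 = ENNReal.ofReal c) :
    HasSum (fun j => ‖x j‖ ^ 2) c := by
  have := ENNReal.hasSum_toReal (f := fun j => ‖x j‖ₑ ^ 2) (by rw [hx]; exact ENNReal.ofReal_ne_top)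
  simp only [← ofReal_norm_sq] at this hx
  rw [← ENNReal.tsum_toReal_eq (fun j => ENNReal.ofReal_ne_top), hx] at this
  simpa [ENNReal.toReal_ofReal, sq_nonneg, hc] using this

/-- Distinct basis vectors are at distance at least one, so the balls of radius `1 / 2` are
disjoint, and a separable space has only countably many disjoint nonempty open sets. -/
theorem countable_of_hilbertBasis [TopologicalSpace.SeparableSpace H] {ι : Type*}
    (b : HilbertBasis ι ℂ H) : Countable ι := by
  have hdist : ∀ i j, i ≠ j → 1 ≤ dist (b i) (b j) := fun i j hij => by
    have h1 : ⟪b i, b i - b j⟫_ℂ = 1 := by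
      rw [inner_sub_right, b.orthonormal.2 hij, inner_self_eq_norm_sq_to_K, b.orthonormal.1 i]
      simp
    have h2 := norm_inner_le_norm (𝕜 := ℂ) (b i) (b i - b j)
    rwa [h1, b.orthonormal.1 i, one_mul, norm_one, ← dist_eq_norm] at h2
  rw [← Set.countable_univ_iff]
  refine Set.PairwiseDisjoint.countable_of_isOpen (s := fun i => Metric.ball (b i) (1 / 2))
    (fun i _ j _ hij => Metric.ball_disjoint_ball ?_) (fun i _ => Metric.isOpen_ball)
    fun i _ => Metric.nonempty_ball.2 (by norm_num)
  norm_num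
  exact hdist i j hij

theorem summable_re_inner {J : Type*} {x : J → H} (hx : Summable fun j => ‖x j‖ ^ 2)
    (B : H →L[ℂ] H) : Summable fun j => (⟪x j, B (x j)⟫_ℂ).re := by
  refine Summable.of_norm_bounded (hx.mul_left ‖B‖) fun j => ?_
  refine (Complex.abs_re_le_norm _).trans ((norm_inner_le_norm _ _).trans ?_)
  nlinarith [B.le_opNorm (x j), norm_nonneg (x j)]

variable [CompleteSpace H]

instance countable_basisIndex [TopologicalSpace.SeparableSpace H] : Countable (basisIndex H) :=
  countable_of_hilbertBasis (basis H)

/-- Both sides are the double sum of the squared matrix entries; in `[0, ∞]` the order of summation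
is free and no Hilbert–Schmidt assumption is needed. -/
theorem tsum_enorm_adjoint_sq {ι : Type*} (b : HilbertBasis ι ℂ H) (V : H →L[ℂ] H) :
    ∑' i, ‖V.adjoint (b i)‖ₑ ^ 2 = ∑' i, ‖V (b i)‖ₑ ^ 2 := by
  simp_rw [← tsum_enorm_inner_sq b]
  rw [ENNReal.tsum_comm]
  refine tsum_congr fun i => tsum_congr fun j => ?_
  rw [ContinuousLinearMap.adjoint_inner_right, enorm_inner_symm]

/-- A positive operator has a square root, which computes its quadratic form. -/
theorem exists_sqrt {B : H →L[ℂ] H} (hB : 0 ≤ B) :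
    ∃ R : H →L[ℂ] H, IsSelfAdjoint R ∧ R ∘L R = B ∧
      ∀ x, ENNReal.ofReal (⟪x, B x⟫_ℂ).re = ‖R x‖ₑ ^ 2 := by
  have hR : IsSelfAdjoint (CFC.sqrt B) := IsSelfAdjoint.of_nonneg (CFC.sqrt_nonneg B)
  have hRR : CFC.sqrt B * CFC.sqrt B = B := CFC.sqrt_mul_sqrt_self B hB
  refine ⟨CFC.sqrt B, hR, hRR, fun x => ?_⟩
  have h1 : ⟪x, B x⟫_ℂ = ⟪CFC.sqrt B x, CFC.sqrt B x⟫_ℂ := by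
    conv_lhs => rw [← hRR]
    rw [mul_apply_eq_comp, ← ContinuousLinearMap.adjoint_inner_left,
      ContinuousLinearMap.isSelfAdjoint_iff'.1 hR]
  rw [h1, ← ofReal_norm_sq, inner_self_eq_norm_sq_to_K]
  norm_cast

theorem cfc_affine {A : H →L[ℂ] H} (hA : IsSelfAdjoint A) (a b : ℝ) :
    cfc (fun t : ℝ => a * t + b) A = a • A + b • 1 := by
  rw [cfc_add (a := A) (fun t : ℝ => a * t) (fun _ => b), cfc_const_mul_id a A, cfc_const b A,
    Algebra.algebraMap_eq_smul_one]

theorem re_inner_cfc_affine {A : H →L[ℂ] H} (hA : IsSelfAdjoint A) (a b : ℝ) (x : H) :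
    (⟪x, cfc (fun t : ℝ => a * t + b) A x⟫_ℂ).re = a * (⟪x, A x⟫_ℂ).re + b * ‖x‖ ^ 2 := by
  rw [cfc_affine hA]
  simp only [add_apply, smul_apply,
    one_apply_eq_self, inner_add_right, Complex.add_re]
  rw [← Complex.coe_smul, ← Complex.coe_smul, inner_smul_right, inner_smul_right,
    Complex.re_ofReal_mul, Complex.re_ofReal_mul, inner_self_eq_norm_sq_to_K]
  norm_cast

theorem re_inner_mono {A B : H →L[ℂ] H} (h : A ≤ B) (x : H) :
    (⟪x, A x⟫_ℂ).re ≤ (⟪x, B x⟫_ℂ).re := by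
  have := (ContinuousLinearMap.nonneg_iff_isPositive _).1 (sub_nonneg.2 h)
  have h2 := this.re_inner_nonneg_right x
  simp only [sub_apply, inner_sub_right, map_sub] at h2
  exact sub_nonneg.1 h2

end Hilbert

end BerezinLieb

/-! ### Berezin–Lieb inequalities for a continuous resolution of the identity -/

namespace BerezinLieb

section Resolution

variable {H : Type*} [NormedAddCommGroup H] [InnerProductSpace ℂ H]
variable {Z J : Type*} [MeasurableSpace Z] {μ : Measure Z} {v : J → Z → H}

/-- The positive operators `∑ⱼ |vⱼ(z)⟩⟨vⱼ(z)|` have trace one and integrate to the identity. -/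
structure IsResolution (μ : Measure Z) (v : J → Z → H) : Prop where
  measurable : ∀ j w, Measurable fun z => ⟪w, v j z⟫_ℂ
  tsum_enorm_sq : ∀ z, ∑' j, ‖v j z‖ₑ ^ 2 = 1
  lintegral_eq : ∀ w, ∫⁻ z, ∑' j, ‖⟪w, v j z⟫_ℂ‖ₑ ^ 2 ∂μ = ‖w‖ₑ ^ 2

theorem IsResolution.hasSum_norm_sq (hv : IsResolution μ v) (z : Z) :
    HasSum (fun j => ‖v j z‖ ^ 2) 1 :=
  hasSum_norm_sq_of_tsum_enorm_sq zero_le_one (by rw [hv.tsum_enorm_sq, ENNReal.ofReal_one])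

theorem IsResolution.measurable_enorm_sq (hv : IsResolution μ v) (j : J) (w : H) :
    Measurable fun z => ‖⟪w, v j z⟫_ℂ‖ₑ ^ 2 :=
  (hv.measurable j w).enorm.pow_const 2

theorem IsResolution.measurable_tsum [Countable J] (hv : IsResolution μ v) (w : H) :
    Measurable fun z => ∑' j, ‖⟪w, v j z⟫_ℂ‖ₑ ^ 2 :=
  Measurable.tsum fun j => hv.measurable_enorm_sq j w

theorem IsResolution.summable_norm_inner_sq (hv : IsResolution μ v) (w : H) (z : Z) :
    Summable fun j => ‖⟪w, v j z⟫_ℂ‖ ^ 2 := by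
  refine Summable.of_nonneg_of_le (fun _ => by positivity) (fun j => ?_)
    ((hv.hasSum_norm_sq z).summable.mul_left (‖w‖ ^ 2))
  rw [← mul_pow]
  exact pow_le_pow_left₀ (norm_nonneg _) (norm_inner_le_norm _ _) 2

theorem IsResolution.ofReal_tsum (hv : IsResolution μ v) (w : H) (z : Z) :
    ENNReal.ofReal (∑' j, ‖⟪w, v j z⟫_ℂ‖ ^ 2) = ∑' j, ‖⟪w, v j z⟫_ℂ‖ₑ ^ 2 := by
  rw [ENNReal.ofReal_tsum_of_nonneg (fun _ => by positivity) (hv.summable_norm_inner_sq w z)]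
  simp_rw [ofReal_norm_sq]

theorem IsResolution.measurable_tsum_norm_sq [Countable J] (hv : IsResolution μ v) (w : H) :
    Measurable fun z => ∑' j, ‖⟪w, v j z⟫_ℂ‖ ^ 2 := by
  have : (fun z => ∑' j, ‖⟪w, v j z⟫_ℂ‖ ^ 2)
      = fun z => (∑' j, ‖⟪w, v j z⟫_ℂ‖ₑ ^ 2).toReal := by
    ext z
    rw [← hv.ofReal_tsum, ENNReal.toReal_ofReal (tsum_nonneg fun _ => by positivity)]
  rw [this]
  exact (hv.measurable_tsum w).ennreal_toReal

theorem IsResolution.integrable_tsum [Countable J] (hv : IsResolution μ v) (w : H) :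
    Integrable (fun z => ∑' j, ‖⟪w, v j z⟫_ℂ‖ ^ 2) μ := by
  refine ⟨(hv.measurable_tsum_norm_sq w).aestronglyMeasurable, ?_⟩
  rw [hasFiniteIntegral_iff_ofReal (ae_of_all _ fun z => tsum_nonneg fun _ => by positivity)]
  simp_rw [hv.ofReal_tsum, hv.lintegral_eq]
  simp

theorem IsResolution.integral_tsum [Countable J] (hv : IsResolution μ v) (w : H) :
    ∫ z, ∑' j, ‖⟪w, v j z⟫_ℂ‖ ^ 2 ∂μ = ‖w‖ ^ 2 := by
  rw [← ENNReal.ofReal_eq_ofReal_iff (integral_nonneg fun z => tsum_nonneg fun _ => by positivity)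
    (by positivity), ofReal_integral_eq_lintegral_ofReal (hv.integrable_tsum w)
    (ae_of_all _ fun z => tsum_nonneg fun _ => by positivity)]
  simp_rw [hv.ofReal_tsum, hv.lintegral_eq, ofReal_norm_sq]

variable [CompleteSpace H]

/-- The integral over phase space of the lower symbol of a positive operator is its trace. -/
theorem IsResolution.lintegral_tsum_inner [TopologicalSpace.SeparableSpace H] [Countable J]
    (hv : IsResolution μ v) {B : H →L[ℂ] H} (hB : 0 ≤ B) :
    ∫⁻ z, ∑' j, ENNReal.ofReal (⟪v j z, B (v j z)⟫_ℂ).re ∂μ = posTrace B := by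
  obtain ⟨R, hR, -, hRB⟩ := exists_sqrt hB
  have h1 : ∀ z, ∑' j, ENNReal.ofReal (⟪v j z, B (v j z)⟫_ℂ).re
      = ∑' i, ∑' j, ‖⟪R (basis H i), v j z⟫_ℂ‖ₑ ^ 2 := fun z => by
    rw [ENNReal.tsum_comm]
    refine tsum_congr fun j => ?_
    rw [hRB, ← tsum_enorm_inner_sq (basis H)]
    refine tsum_congr fun i => ?_
    rw [← ContinuousLinearMap.adjoint_inner_left, ContinuousLinearMap.isSelfAdjoint_iff'.1 hR]
  simp_rw [h1]
  rw [lintegral_tsum fun i => (hv.measurable_tsum _).aemeasurable]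
  simp_rw [hv.lintegral_eq]
  exact tsum_congr fun i => (hRB _).symm

/-! ### Lower symbols: Jensen's inequality in a trace one state -/

theorem tsum_re_inner_mono {x : J → H} (hx : Summable fun j => ‖x j‖ ^ 2) {A B : H →L[ℂ] H}
    (h : A ≤ B) : ∑' j, (⟪x j, A (x j)⟫_ℂ).re ≤ ∑' j, (⟪x j, B (x j)⟫_ℂ).re :=
  (summable_re_inner hx A).tsum_le_tsum (fun j => re_inner_mono h (x j)) (summable_re_inner hx B)

theorem tsum_re_inner_affine {x : J → H} (hx : HasSum (fun j => ‖x j‖ ^ 2) 1) {T : H →L[ℂ] H}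
    (hT : IsSelfAdjoint T) (a b : ℝ) :
    ∑' j, (⟪x j, cfc (fun t : ℝ => a * t + b) T (x j)⟫_ℂ).re
      = a * ∑' j, (⟪x j, T (x j)⟫_ℂ).re + b := by
  simp_rw [re_inner_cfc_affine hT]
  rw [((summable_re_inner hx.summable T).mul_left a).tsum_add (hx.summable.mul_left b),
    tsum_mul_left, tsum_mul_left, hx.tsum_eq, mul_one]

/-- Jensen's inequality for hinge sums. -/
theorem IsHingeSum.le_tsum_re_inner {Ψ : ℝ → ℝ} (hΨ : IsHingeSum Ψ) {x : J → H}
    (hx : HasSum (fun j => ‖x j‖ ^ 2) 1) {T : H →L[ℂ] H} (hT : IsSelfAdjoint T) :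
    Ψ (∑' j, (⟪x j, T (x j)⟫_ℂ).re) ≤ ∑' j, (⟪x j, cfc Ψ T (x j)⟫_ℂ).re := by
  induction hΨ with
  | hinge a b =>
    -- An affine function commutes with averaging in a state of trace one, and the hinge dominates
    -- both its affine part and zero.
    refine max_le ?_ ?_
    · rw [← tsum_re_inner_affine hx hT]
      exact tsum_re_inner_mono hx.summable (cfc_mono fun t _ => le_max_left _ _)
    · have := tsum_re_inner_mono hx.summable (A := 0)
        (cfc_nonneg (f := fun t : ℝ => max (a * t + b) 0) (a := T) fun t _ => le_max_right _ _)
      simpa using this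
  | @add f g hf hg h1 h2 =>
    have hf' := hf.continuous.continuousOn (s := spectrum ℝ T)
    have hg' := hg.continuous.continuousOn (s := spectrum ℝ T)
    rw [cfc_add (a := T) f g hf' hg']
    simp only [add_apply, inner_add_right, Complex.add_re]
    rw [(summable_re_inner hx.summable _).tsum_add (summable_re_inner hx.summable _)]
    exact add_le_add h1 h2

/-- Hinge approximation needs a compact interval; convexity of `D` keeps the interval spanned by the
extreme points of `C` inside `D`. -/
theorem exists_Icc_of_isCompact {C D : Set ℝ} (hC : IsCompact C) (hne : C.Nonempty) (hCD : C ⊆ D)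
    (hD : Convex ℝ D) : ∃ m M, m ∈ C ∧ M ∈ C ∧ m ≤ M ∧ C ⊆ Set.Icc m M ∧ Set.Icc m M ⊆ D := by
  obtain ⟨m, hm⟩ := hC.exists_isLeast hne
  obtain ⟨M, hM⟩ := hC.exists_isGreatest hne
  exact ⟨m, M, hm.1, hM.1, hm.2 hM.1, fun t ht => ⟨hm.2 ht, hM.2 ht⟩,
    hD.ordConnected.out (hCD hm.1) (hCD hM.1)⟩

/-- Jensen's inequality for vector states. -/
theorem le_tsum_re_inner_cfc [Nontrivial H] {x : J → H}
    (hx : HasSum (fun j => ‖x j‖ ^ 2) 1) {T : H →L[ℂ] H} (hT : IsSelfAdjoint T) {D : Set ℝ}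
    {Φ : ℝ → ℝ} (hΦ : ConvexOn ℝ D Φ) (hcont : ContinuousOn Φ D) (hpos : ∀ t ∈ D, 0 ≤ Φ t)
    (hTD : spectrum ℝ T ⊆ D) :
    Φ (∑' j, (⟪x j, T (x j)⟫_ℂ).re) ≤ ∑' j, (⟪x j, cfc Φ T (x j)⟫_ℂ).re := by
  obtain ⟨m, M, hm, hM, hmM, hI, hID⟩ := exists_Icc_of_isCompact (spectrum.isCompact T)
    (ContinuousFunctionalCalculus.spectrum_nonempty T hT) hTD hΦ.1
  -- Since `m ≤ t ≤ M` on the spectrum, monotonicity of the functional calculus bounds `T` by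
  -- multiples of the identity. The constants are written as affine functions of slope zero.
  have hmem : ∑' j, (⟪x j, T (x j)⟫_ℂ).re ∈ Set.Icc m M := by
    have hid : cfc (fun t : ℝ => 1 * t + 0) T = T := by rw [cfc_affine hT]; simp
    constructor
    · have h1 := tsum_re_inner_affine hx hT 0 m
      rw [zero_mul, zero_add] at h1
      rw [← h1]
      conv_rhs => rw [← hid]
      exact tsum_re_inner_mono hx.summable (cfc_mono fun t ht => by linarith [(hI ht).1])
    · have h1 := tsum_re_inner_affine hx hT 0 M
      rw [zero_mul, zero_add] at h1
      rw [← h1]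
      conv_lhs => rw [← hid]
      exact tsum_re_inner_mono hx.summable (cfc_mono fun t ht => by linarith [(hI ht).2])
  refine le_of_forall_pos_le_add fun ε hε => ?_
  obtain ⟨Ψ, hΨ, hb⟩ := exists_isHingeSum hmM hε (hΦ.subset hID (convex_Icc _ _))
    (hcont.mono hID) fun t ht => hpos t (hID ht)
  refine (hb _ hmem).2.trans (add_le_add_left ((hΨ.le_tsum_re_inner hx hT).trans ?_) ε)
  exact tsum_re_inner_mono hx.summable (cfc_mono (fun t ht => (hb t (hI ht)).1)
    hΨ.continuous.continuousOn (hcont.mono hTD))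

/-- The Berezin–Lieb inequality for lower symbols. -/
theorem IsResolution.lintegral_comp_le_posTrace [Nontrivial H] [TopologicalSpace.SeparableSpace H]
    [Countable J] (hv : IsResolution μ v) {T : H →L[ℂ] H} (hT : IsSelfAdjoint T) {D : Set ℝ}
    {Φ : ℝ → ℝ} (hΦ : ConvexOn ℝ D Φ) (hcont : ContinuousOn Φ D) (hpos : ∀ t ∈ D, 0 ≤ Φ t)
    (hTD : spectrum ℝ T ⊆ D) :
    ∫⁻ z, ENNReal.ofReal (Φ (∑' j, (⟪v j z, T (v j z)⟫_ℂ).re)) ∂μ ≤ posTrace (cfc Φ T) := by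
  have h0 : 0 ≤ cfc Φ T := cfc_nonneg fun t ht => hpos t (hTD ht)
  rw [← hv.lintegral_tsum_inner h0]
  refine lintegral_mono fun z => ?_
  rw [← ENNReal.ofReal_tsum_of_nonneg (fun j => by simpa using re_inner_mono h0 (v j z))
    (summable_re_inner (hv.hasSum_norm_sq z).summable _)]
  exact ENNReal.ofReal_le_ofReal
    (le_tsum_re_inner_cfc (hv.hasSum_norm_sq z) hT hΦ hcont hpos hTD)

/-! ### Upper symbols: compression to the support of a positive part -/

/-- If `B C = 0` for self-adjoint `B` and `C`, the compression of `B - C` to the support of `B`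
is `B`. -/
theorem exists_compression {B C : H →L[ℂ] H} (hB : IsSelfAdjoint B)
    (hBC : B ∘L C = 0) :
    ∃ P : H →L[ℂ] H, (∀ x y, ⟪P x, y⟫_ℂ = ⟪x, P y⟫_ℂ) ∧ (∀ x, ‖P x‖ ≤ ‖x‖) ∧
      ∀ x, ⟪x, B x⟫_ℂ = ⟪P x, (B - C) (P x)⟫_ℂ := by
  have hcl : IsClosed (B.ker : Set H) := B.isClosed_ker
  have : CompleteSpace B.ker := hcl.completeSpace_coe
  have hsymm : ∀ {X : H →L[ℂ] H}, IsSelfAdjoint X → ∀ x y, ⟪X x, y⟫_ℂ = ⟪x, X y⟫_ℂ :=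
    fun {X} hX x y => by
      rw [← ContinuousLinearMap.adjoint_inner_right, ContinuousLinearMap.isSelfAdjoint_iff'.1 hX]
  -- `P` projects onto `(ker B)ᗮ`. The range of `C` lies in `ker B`, so the form of `C` vanishes on
  -- the range of `P`.
  refine ⟨B.kerᗮ.starProjection, fun x y => Submodule.inner_starProjection_left_eq_right _ x y,
    fun x => Submodule.norm_starProjection_apply_le _ x, fun x => ?_⟩
  set p := B.kerᗮ.starProjection x with hp
  have hBp : B p = B x := by
    have : x - p ∈ B.ker := by
      have h1 := Submodule.sub_starProjection_mem_orthogonal (K := B.kerᗮ) x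
      rwa [Submodule.orthogonal_orthogonal] at h1
    have h2 : B (x - p) = 0 := this
    rw [map_sub, sub_eq_zero] at h2
    exact h2.symm
  have hCp : ⟪p, C p⟫_ℂ = 0 := by
    have h1 : C p ∈ B.ker := congrArg (fun X : H →L[ℂ] H => X p) hBC
    have h2 : p ∈ B.kerᗮ := Submodule.starProjection_apply_mem _ x
    exact Submodule.inner_left_of_mem_orthogonal h1 h2
  rw [sub_apply, inner_sub_right, hCp, sub_zero, hBp, ← hsymm hB p, hBp, hsymm hB]

theorem ofReal_integral_le_lintegral {g : Z → ℝ} (hg : Integrable g μ) :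
    ENNReal.ofReal (∫ z, g z ∂μ) ≤ ∫⁻ z, ENNReal.ofReal (g z) ∂μ := by
  calc ENNReal.ofReal (∫ z, g z ∂μ) ≤ ENNReal.ofReal (∫ z, max (g z) 0 ∂μ) :=
        ENNReal.ofReal_le_ofReal (integral_mono hg hg.pos_part fun z => le_max_left _ _)
    _ = ∫⁻ z, ENNReal.ofReal (max (g z) 0) ∂μ :=
        ofReal_integral_eq_lintegral_ofReal hg.pos_part (ae_of_all _ fun z => le_max_right _ _)
    _ = ∫⁻ z, ENNReal.ofReal (g z) ∂μ := by simp [ENNReal.ofReal_max]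

/-- The trace estimate behind the Berezin–Lieb inequality for upper symbols. -/
theorem IsResolution.tsum_lintegral_le [TopologicalSpace.SeparableSpace H] [Countable J]
    (hv : IsResolution μ v) {g : Z → ℝ≥0∞} (hg : AEMeasurable g μ) {P : H →L[ℂ] H}
    (hP : ∀ x y, ⟪P x, y⟫_ℂ = ⟪x, P y⟫_ℂ) (hP1 : ∀ x, ‖P x‖ ≤ ‖x‖) :
    ∑' i, ∫⁻ z, g z * ∑' j, ‖⟪P (basis H i), v j z⟫_ℂ‖ₑ ^ 2 ∂μ ≤ ∫⁻ z, g z ∂μ := by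
  have hm : ∀ i, AEMeasurable (fun z => g z * ∑' j, ‖⟪P (basis H i), v j z⟫_ℂ‖ₑ ^ 2) μ :=
    fun i => hg.mul (hv.measurable_tsum _).aemeasurable
  rw [← lintegral_tsum hm]
  refine lintegral_mono fun z => ?_
  simp only
  -- With `P` moved onto `vⱼ(z)`, Parseval turns the sum over the basis into `∑ⱼ ‖P vⱼ(z)‖² ≤ 1`.
  rw [ENNReal.tsum_mul_left, ENNReal.tsum_comm]
  simp_rw [hP, tsum_enorm_inner_sq]
  have hP2 : ∀ x, ‖P x‖ₑ ≤ ‖x‖ₑ := fun x => by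
    rw [← ofReal_norm, ← ofReal_norm]
    exact ENNReal.ofReal_le_ofReal (hP1 x)
  calc g z * ∑' j, ‖P (v j z)‖ₑ ^ 2 ≤ g z * ∑' j, ‖v j z‖ₑ ^ 2 := by
        gcongr
        exact hP2 _
    _ = g z := by rw [hv.tsum_enorm_sq, mul_one]

/-- With `h(t) = a t + b` and `P` the projection onto the support of `h₊(A)`, one has `⟨e, h₊(A) e⟩
= ⟨P e, h(A) P e⟩`. The right side is linear in `A`, hence equals `∫ h(f) ∑ⱼ |⟨P e, vⱼ⟩|²`;
replacing `h` by `h₊` under the integral and summing over the basis gives the bound. -/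
theorem IsResolution.posTrace_cfc_hinge_le [TopologicalSpace.SeparableSpace H] [Countable J]
    (hv : IsResolution μ v) {f : Z → ℝ} (hf : AEMeasurable f μ) {A : H →L[ℂ] H}
    (hA : IsSelfAdjoint A)
    (hint : ∀ w, Integrable (fun z => f z * ∑' j, ‖⟪w, v j z⟫_ℂ‖ ^ 2) μ)
    (hform : ∀ w, (⟪w, A w⟫_ℂ).re = ∫ z, f z * ∑' j, ‖⟪w, v j z⟫_ℂ‖ ^ 2 ∂μ) (a b : ℝ) :
    posTrace (cfc (fun t : ℝ => max (a * t + b) 0) A)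
      ≤ ∫⁻ z, ENNReal.ofReal (max (a * f z + b) 0) ∂μ := by
  set Bp := cfc (fun t : ℝ => max (a * t + b) 0) A with hBp
  set Bm := cfc (fun t : ℝ => max (-(a * t + b)) 0) A with hBm
  have hmul : Bp ∘L Bm = 0 := by
    change Bp * Bm = 0
    rw [hBp, hBm, ← cfc_mul (a := A) (fun t : ℝ => max (a * t + b) 0)
      (fun t : ℝ => max (-(a * t + b)) 0), ← cfc_zero ℝ A]
    congr 1
    ext t
    rcases le_total (a * t + b) 0 with h | h
    · simp [max_eq_right h]
    · rw [max_eq_right (neg_nonpos.2 h), mul_zero]; rfl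
  have hsub : Bp - Bm = cfc (fun t : ℝ => a * t + b) A := by
    rw [hBp, hBm, ← cfc_sub (a := A) (fun t : ℝ => max (a * t + b) 0)
      (fun t : ℝ => max (-(a * t + b)) 0)]
    congr 1
    ext t
    rcases le_total (a * t + b) 0 with h | h
    · rw [max_eq_right h, max_eq_left (neg_nonneg.2 h)]; ring
    · rw [max_eq_left h, max_eq_right (neg_nonpos.2 h)]; ring
  obtain ⟨P, hP, hP1, hPB⟩ := exists_compression (cfc_predicate _ A : IsSelfAdjoint Bp) hmul
  refine le_trans (ENNReal.tsum_le_tsum fun i => ?_)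
    (hv.tsum_lintegral_le (g := fun z => ENNReal.ofReal (max (a * f z + b) 0))
      ((((hf.const_mul a).add_const b).max aemeasurable_const).ennreal_ofReal) hP hP1)
  set w := P (basis H i) with hw
  rw [hPB, ← hw, hsub, re_inner_cfc_affine hA, hform, ← hv.integral_tsum, ← integral_const_mul,
    ← integral_const_mul,
    ← integral_add ((hint w).const_mul a) ((hv.integrable_tsum w).const_mul b)]
  refine (ofReal_integral_le_lintegral
    (((hint w).const_mul a).add ((hv.integrable_tsum w).const_mul b))).trans
    (lintegral_mono fun z => ?_)
  simp only [Pi.add_apply]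
  rw [← hv.ofReal_tsum, ← mul_assoc, ← add_mul,
    ← ENNReal.ofReal_mul' (tsum_nonneg fun _ => by positivity)]
  exact ENNReal.ofReal_le_ofReal
    (mul_le_mul_of_nonneg_right (le_max_left _ _) (tsum_nonneg fun _ => by positivity))

theorem posTrace_add {A B : H →L[ℂ] H} (hA : 0 ≤ A) (hB : 0 ≤ B) :
    posTrace (A + B) = posTrace A + posTrace B := by
  rw [posTrace, posTrace, posTrace, ← ENNReal.tsum_add]
  refine tsum_congr fun i => ?_
  rw [add_apply, inner_add_right, Complex.add_re, ENNReal.ofReal_add]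
  · simpa using re_inner_mono hA (basis H i)
  · simpa using re_inner_mono hB (basis H i)

theorem IsResolution.posTrace_cfc_isHingeSum_le [TopologicalSpace.SeparableSpace H] [Countable J]
    (hv : IsResolution μ v) {f : Z → ℝ} (hf : AEMeasurable f μ) {A : H →L[ℂ] H}
    (hA : IsSelfAdjoint A)
    (hint : ∀ w, Integrable (fun z => f z * ∑' j, ‖⟪w, v j z⟫_ℂ‖ ^ 2) μ)
    (hform : ∀ w, (⟪w, A w⟫_ℂ).re = ∫ z, f z * ∑' j, ‖⟪w, v j z⟫_ℂ‖ ^ 2 ∂μ) {Ψ : ℝ → ℝ}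
    (hΨ : IsHingeSum Ψ) :
    posTrace (cfc Ψ A) ≤ ∫⁻ z, ENNReal.ofReal (Ψ (f z)) ∂μ := by
  induction hΨ with
  | hinge a b => exact hv.posTrace_cfc_hinge_le hf hA hint hform a b
  | @add g h hg hh h1 h2 =>
    have hg0 : 0 ≤ cfc g A := cfc_nonneg fun t _ => hg.nonneg t
    have hh0 : 0 ≤ cfc h A := cfc_nonneg fun t _ => hh.nonneg t
    rw [cfc_add (a := A) g h hg.continuous.continuousOn hh.continuous.continuousOn,
      posTrace_add hg0 hh0]
    simp_rw [ENNReal.ofReal_add (hg.nonneg _) (hh.nonneg _)]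
    have hm : AEMeasurable (fun z => ENNReal.ofReal (g (f z))) μ :=
      ENNReal.measurable_ofReal.comp_aemeasurable
        (hg.continuous.measurable.comp_aemeasurable hf)
    rw [lintegral_add_left' hm]
    exact add_le_add h1 h2

/-- The Berezin–Lieb inequality for upper symbols. -/
theorem IsResolution.posTrace_le_lintegral_comp [Nontrivial H] [TopologicalSpace.SeparableSpace H]
    [Countable J] (hv : IsResolution μ v) {f : Z → ℝ} (hf : AEMeasurable f μ) {A : H →L[ℂ] H}
    (hA : IsSelfAdjoint A)
    (hint : ∀ w, Integrable (fun z => f z * ∑' j, ‖⟪w, v j z⟫_ℂ‖ ^ 2) μ)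
    (hform : ∀ w, (⟪w, A w⟫_ℂ).re = ∫ z, f z * ∑' j, ‖⟪w, v j z⟫_ℂ‖ ^ 2 ∂μ) {C D : Set ℝ}
    (hC : IsCompact C) (hCD : C ⊆ D) (hfC : ∀ᵐ z ∂μ, f z ∈ C)
    {Φ : ℝ → ℝ} (hΦ : ConvexOn ℝ D Φ) (hcont : ContinuousOn Φ D) (hpos : ∀ t ∈ D, 0 ≤ Φ t)
    (hAD : spectrum ℝ A ⊆ D) :
    posTrace (cfc Φ A) ≤ ∫⁻ z, ENNReal.ofReal (Φ (f z)) ∂μ := by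
  -- One interval has to contain both the spectrum of `A` and almost all values of `f`.
  obtain ⟨m, M, hm, hM, hmM, hI, hID⟩ := exists_Icc_of_isCompact
    ((spectrum.isCompact (𝕜 := ℝ) A).union hC)
    ((ContinuousFunctionalCalculus.spectrum_nonempty A hA).mono Set.subset_union_left)
    (Set.union_subset hAD hCD) hΦ.1
  rw [posTrace, ENNReal.tsum_eq_iSup_sum]
  refine iSup_le fun s => ?_
  refine ENNReal.le_of_forall_pos_le_add fun δ hδ _ => ?_
  -- A uniform error `ε` costs `ε` for each unit vector, hence `s.card * ε` on a finite partial sum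
  -- of the trace.
  obtain ⟨ε, hε, hεδ⟩ : ∃ ε : ℝ, 0 < ε ∧ s.card * ε ≤ δ := by
    refine ⟨δ / (s.card + 1), by positivity, ?_⟩
    rw [mul_div_assoc', div_le_iff₀ (by positivity)]
    have : (0 : ℝ) < δ := hδ
    nlinarith
  obtain ⟨Ψ, hΨ, hb⟩ := exists_isHingeSum hmM hε (hΦ.subset hID (convex_Icc _ _))
    (hcont.mono hID) fun t ht => hpos t (hID ht)
  have hterm : ∀ i, ENNReal.ofReal (⟪basis H i, cfc Φ A (basis H i)⟫_ℂ).re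
      ≤ ENNReal.ofReal (⟪basis H i, cfc Ψ A (basis H i)⟫_ℂ).re + ENNReal.ofReal ε := fun i => by
    refine le_trans (ENNReal.ofReal_le_ofReal ?_) ENNReal.ofReal_add_le
    have h1 : cfc Φ A ≤ cfc (fun t => Ψ t + (0 * t + ε)) A :=
      cfc_mono (fun t ht => by linarith [(hb t (hI (Or.inl ht))).2]) (hcont.mono hAD)
        (hΨ.continuous.add (by fun_prop)).continuousOn
    refine (re_inner_mono h1 _).trans_eq ?_
    rw [cfc_add (a := A) Ψ (fun t => 0 * t + ε) hΨ.continuous.continuousOn, add_apply,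
      inner_add_right, Complex.add_re, re_inner_cfc_affine hA, (basis H).orthonormal.1]
    ring
  calc ∑ i ∈ s, ENNReal.ofReal (⟪basis H i, cfc Φ A (basis H i)⟫_ℂ).re
      ≤ ∑ i ∈ s, (ENNReal.ofReal (⟪basis H i, cfc Ψ A (basis H i)⟫_ℂ).re + ENNReal.ofReal ε) :=
        Finset.sum_le_sum fun i _ => hterm i
    _ ≤ posTrace (cfc Ψ A) + δ := by
        rw [Finset.sum_add_distrib, Finset.sum_const, nsmul_eq_mul]
        refine add_le_add (ENNReal.sum_le_tsum s) ?_
        rw [← ENNReal.ofReal_natCast, ← ENNReal.ofReal_mul (Nat.cast_nonneg _),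
          ← ENNReal.ofReal_coe_nnreal]
        exact ENNReal.ofReal_le_ofReal hεδ
    _ ≤ ∫⁻ z, ENNReal.ofReal (Ψ (f z)) ∂μ + δ :=
        add_le_add_left (hv.posTrace_cfc_isHingeSum_le hf hA hint hform hΨ) _
    _ ≤ ∫⁻ z, ENNReal.ofReal (Φ (f z)) ∂μ + δ := by
        refine add_le_add_left (lintegral_mono_ae ?_) _
        filter_upwards [hfC] with z hz
        exact ENNReal.ofReal_le_ofReal (hb _ (hI (Or.inr hz))).1

end Resolution

end BerezinLieb

/-! ### Plancherel's theorem and Moyal's identity -/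

namespace BerezinLieb

open scoped FourierTransform

theorem lintegral_enorm_sq {α : Type*} [MeasurableSpace α] {μ : Measure α} (f : Lp ℂ 2 μ) :
    ∫⁻ x, ‖f x‖ₑ ^ 2 ∂μ = ‖f‖ₑ ^ 2 := by
  rw [Lp.enorm_def, eLpNorm_eq_lintegral_rpow_enorm_toReal (by norm_num) (by norm_num)]
  simp only [ENNReal.toReal_ofNat, ENNReal.rpow_two]
  rw [← ENNReal.rpow_two, ← ENNReal.rpow_mul]
  norm_num

section Plancherel

variable {V : Type*} [NormedAddCommGroup V] [InnerProductSpace ℝ V] [FiniteDimensional ℝ V]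
  [MeasurableSpace V] [BorelSpace V]

/-- The `L²`-Fourier transform of an integrable function is given by the Fourier integral. -/
theorem fourier_toLp_ae_eq {g : V → ℂ} (hg : Integrable g) (hg2 : MemLp g 2) :
    (𝓕 (hg2.toLp g) : Lp ℂ 2 (volume : Measure V)) =ᵐ[volume] 𝓕 g := by
  have hcont : Continuous (𝓕 g) :=
    VectorFourier.fourierIntegral_continuous Real.continuous_fourierChar continuous_inner hg
  -- Both functions are tested against smooth compactly supported `φ`: the `L²` transform is the
  -- distributional one, and the integral formula moves onto `φ` by Fubini.
  refine ae_eq_of_integral_contDiff_smul_eq ((Lp.memLp _).locallyIntegrable one_le_two)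
    hcont.locallyIntegrable fun φ hφ hφc => ?_
  have h1 : HasCompactSupport (Complex.ofRealCLM ∘ φ) := hφc.comp_left rfl
  have h2 : ContDiff ℝ (⊤ : ℕ∞) (Complex.ofRealCLM ∘ φ) := by fun_prop
  set s : SchwartzMap V ℂ := h1.toSchwartzMap h2 with hs
  have hsφ : ∀ x, s x = φ x := fun x => rfl
  have h3 := congrArg (fun T => T s) (Lp.fourier_toTemperedDistribution_eq (hg2.toLp g))
  simp only [TemperedDistribution.fourier_apply, Lp.toTemperedDistribution_apply] at h3
  have h4 : ∫ x, (𝓕 s) x • (hg2.toLp g) x = ∫ x, (𝓕 s) x • g x := by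
    refine integral_congr_ae ?_
    filter_upwards [hg2.coeFn_toLp] with x hx
    rw [hx]
  have h5 : ∫ x, (𝓕 s) x • g x = ∫ x, s x • 𝓕 g x := by
    have := VectorFourier.integral_fourierIntegral_smul_eq_flip (μ := volume) (ν := volume)
      (L := innerₗ V) Real.continuous_fourierChar continuous_inner s.integrable hg
    rw [flip_innerₗ] at this
    exact this
  simp_rw [hsφ] at h3 h5
  rw [h4, h5] at h3
  exact h3.symm

theorem lintegral_fourier_sq {g : V → ℂ} (hg : Integrable g) (hg2 : MemLp g 2) :
    ∫⁻ w, ‖𝓕 g w‖ₑ ^ 2 = ∫⁻ x, ‖g x‖ₑ ^ 2 := by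
  have h1 : ∫⁻ w, ‖𝓕 g w‖ₑ ^ 2
      = ∫⁻ w, ‖(𝓕 (hg2.toLp g) : Lp ℂ 2 (volume : Measure V)) w‖ₑ ^ 2 := by
    refine lintegral_congr_ae ?_
    filter_upwards [fourier_toLp_ae_eq hg hg2] with x hx
    rw [hx]
  have h2 : ∫⁻ w, ‖g w‖ₑ ^ 2 = ∫⁻ w, ‖hg2.toLp g w‖ₑ ^ 2 := by
    refine lintegral_congr_ae ?_
    filter_upwards [hg2.coeFn_toLp] with x hx
    rw [hx]
  rw [h1, h2, lintegral_enorm_sq, lintegral_enorm_sq, ← ofReal_norm, Lp.norm_fourier_eq,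
    ofReal_norm]

theorem lintegral_fourierInv_sq {g : V → ℂ} (hg : Integrable g) (hg2 : MemLp g 2) :
    ∫⁻ w, ‖𝓕⁻ g w‖ₑ ^ 2 = ∫⁻ x, ‖g x‖ₑ ^ 2 := by
  simp_rw [Real.fourierInv_eq_fourier_neg]
  rw [lintegral_neg_eq_self (fun w => ‖𝓕 g w‖ₑ ^ 2), lintegral_fourier_sq hg hg2]

end Plancherel

open scoped ComplexConjugate

variable {d : ℕ}

theorem inner_timeFreqShift (w r : L2 d) (z : Phase d) :
    ⟪w, timeFreqShift z r⟫_ℂ = ∫ t, character z.2 t * (conj (w t) * r (t - z.1)) := by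
  rw [L2.inner_def]
  refine integral_congr_ae ?_
  filter_upwards [timeFreqShift_apply_ae z r] with t ht
  rw [ht, RCLike.inner_apply]
  ring

/-- For fixed `x` the matrix coefficient is an inverse Fourier transform in `ω`, so Plancherel
evaluates the `ω`-integral in Moyal's identity. -/
theorem inner_timeFreqShift_eq_fourierInv (w r : L2 d) (z : Phase d) :
    ⟪w, timeFreqShift z r⟫_ℂ = 𝓕⁻ (fun t => conj (w t) * r (t - z.1)) z.2 := by
  rw [inner_timeFreqShift, Real.fourierInv_eq']
  refine integral_congr_ae (ae_of_all _ fun t => ?_)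
  simp only [character, smul_eq_mul]
  rw [real_inner_comm]
  congr 2
  push_cast
  ring

theorem measurable_inner_timeFreqShift (w r : L2 d) :
    Measurable fun z => ⟪w, timeFreqShift z r⟫_ℂ := by
  simp_rw [inner_timeFreqShift]
  have h : StronglyMeasurable fun p : Phase d × Space d =>
      character p.1.2 p.2 * (conj (w p.2) * r (p.2 - p.1.1)) := by
    refine StronglyMeasurable.mul ?_ (StronglyMeasurable.mul ?_ ?_)
    · refine Continuous.stronglyMeasurable ?_
      unfold character
      fun_prop
    · exact Complex.continuous_conj.comp_stronglyMeasurable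
        ((Lp.stronglyMeasurable w).comp_measurable measurable_snd)
    · exact (Lp.stronglyMeasurable r).comp_measurable
        (measurable_snd.sub (measurable_fst.comp measurable_fst))
  exact h.integral_prod_right.measurable

/-- Moyal's identity. -/
theorem lintegral_inner_timeFreqShift_sq (w r : L2 d) :
    ∫⁻ z, ‖⟪w, timeFreqShift z r⟫_ℂ‖ₑ ^ 2 = ‖w‖ₑ ^ 2 * ‖r‖ₑ ^ 2 := by
  have hwm : Measurable fun t => ‖w t‖ₑ ^ 2 :=
    (Lp.stronglyMeasurable w).measurable.enorm.pow_const 2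
  have hrm : Measurable fun p : Space d × Space d => ‖r (p.2 - p.1)‖ₑ ^ 2 :=
    ((Lp.stronglyMeasurable r).measurable.comp
      (measurable_snd.sub measurable_fst)).enorm.pow_const 2
  have hgm : Measurable fun p : Space d × Space d => ‖conj (w p.2) * r (p.2 - p.1)‖ₑ ^ 2 := by
    simp_rw [enorm_mul, mul_pow, RCLike.enorm_conj]
    exact (hwm.comp measurable_snd).mul hrm
  have htot : ∫⁻ x : Space d, ∫⁻ t : Space d, ‖conj (w t) * r (t - x)‖ₑ ^ 2
      = ‖w‖ₑ ^ 2 * ‖r‖ₑ ^ 2 := by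
    rw [lintegral_lintegral_swap hgm.aemeasurable]
    simp_rw [enorm_mul, mul_pow, RCLike.enorm_conj]
    have h1 : ∀ t : Space d, ∫⁻ x, ‖w t‖ₑ ^ 2 * ‖r (t - x)‖ₑ ^ 2 = ‖w t‖ₑ ^ 2 * ‖r‖ₑ ^ 2 :=
      fun t => by
        have hm : Measurable fun x => ‖r (t - x)‖ₑ ^ 2 :=
          ((Lp.stronglyMeasurable r).measurable.comp
            (measurable_const.sub measurable_id)).enorm.pow_const 2
        rw [lintegral_const_mul _ hm, lintegral_sub_left_eq_self (fun x => ‖r x‖ₑ ^ 2) t,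
          lintegral_enorm_sq]
    simp_rw [h1]
    rw [lintegral_mul_const _ hwm, lintegral_enorm_sq]
  -- A product of two `L²` functions is only integrable in general; the finite total integral makes
  -- it square integrable for almost every shift `x`, as Plancherel requires.
  have hfin : ∀ᵐ x : Space d, ∫⁻ t : Space d, ‖conj (w t) * r (t - x)‖ₑ ^ 2 < ∞ := by
    refine ae_lt_top hgm.lintegral_prod_right' ?_
    rw [htot]
    exact ENNReal.mul_ne_top (by simp) (by simp)
  rw [Measure.volume_eq_prod,
    lintegral_prod _ ((measurable_inner_timeFreqShift w r).enorm.pow_const 2).aemeasurable, ← htot]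
  refine lintegral_congr_ae ?_
  filter_upwards [hfin] with x hx
  simp_rw [inner_timeFreqShift_eq_fourierInv]
  have hr : MemLp (fun t => r (t - x)) 2 (volume : Measure (Space d)) :=
    (Lp.memLp r).comp_measurePreserving (measurePreserving_sub_right volume x)
  have hw : MemLp (fun t => conj (w t)) 2 (volume : Measure (Space d)) := (Lp.memLp w).star
  refine lintegral_fourierInv_sq (hw.integrable_mul hr)
    ⟨hw.aestronglyMeasurable.mul hr.aestronglyMeasurable, ?_⟩
  rw [eLpNorm_lt_top_iff_lintegral_rpow_enorm_lt_top (by norm_num) (by norm_num)]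
  simpa using hx

/-! ### Unitarity of time-frequency shifts and parity -/

theorem norm_timeFreqShift (z : Phase d) (r : L2 d) : ‖timeFreqShift z r‖ = ‖r‖ := by
  have h : ‖timeFreqShift z r‖ₑ ^ 2 = ‖r‖ₑ ^ 2 := by
    rw [← lintegral_enorm_sq, ← lintegral_enorm_sq,
      ← lintegral_sub_right_eq_self (fun x => ‖r x‖ₑ ^ 2) z.1]
    refine lintegral_congr_ae ?_
    filter_upwards [timeFreqShift_apply_ae z r] with t ht
    rw [ht, enorm_mul]
    have : ‖character z.2 t‖ₑ = 1 := by
      rw [character, show 2 * (Real.pi : ℂ) * Complex.I * ((⟪z.2, t⟫_ℝ : ℝ) : ℂ)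
        = ((2 * Real.pi * ⟪z.2, t⟫_ℝ : ℝ) : ℂ) * Complex.I by push_cast; ring, ← ofReal_norm,
        Complex.norm_exp_ofReal_mul_I, ENNReal.ofReal_one]
    rw [this, one_mul]
  rw [← ofReal_norm_sq, ← ofReal_norm_sq,
    ENNReal.ofReal_eq_ofReal_iff (by positivity) (by positivity)] at h
  exact (sq_eq_sq₀ (norm_nonneg _) (norm_nonneg _)).1 h

theorem timeFreqShift_timeFreqShift_neg (z : Phase d) (r : L2 d) :
    timeFreqShift z (timeFreqShift (-z) r) = character z.2 z.1 • r := by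
  refine Lp.ext ?_
  have h1 := (measurePreserving_sub_right volume z.1).quasiMeasurePreserving.ae_eq_comp
    (timeFreqShift_apply_ae (-z) r)
  filter_upwards [timeFreqShift_apply_ae z (timeFreqShift (-z) r), h1,
    Lp.coeFn_smul (character z.2 z.1) r] with t h1 h2 h3
  simp only [Function.comp_apply] at h2
  rw [h1, h2, h3, Pi.smul_apply, smul_eq_mul, ← mul_assoc]
  congr 2
  · simp only [character, ← Complex.exp_add, Prod.snd_neg, inner_neg_left, inner_sub_right]
    congr 1
    push_cast
    ring
  · simp

/-- An isometry has its adjoint as left inverse. It is also a right inverse because `π(z)` is onto: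
`π(z) π(-z)` is a nonzero scalar. -/
theorem timeFreqShift_adjoint_apply (z : Phase d) (r : L2 d) :
    timeFreqShift z ((timeFreqShift z).adjoint r) = r := by
  have hc : character z.2 z.1 ≠ 0 := Complex.exp_ne_zero _
  have hadj : ∀ s, (timeFreqShift z).adjoint (timeFreqShift z s) = s := fun s => by
    have := (ContinuousLinearMap.norm_map_iff_adjoint_comp_self (timeFreqShift z)).1
      (norm_timeFreqShift z)
    exact congrArg (fun X : L2 d →L[ℂ] L2 d => X s) this
  obtain ⟨s, rfl⟩ : ∃ s, timeFreqShift z s = r :=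
    ⟨(character z.2 z.1)⁻¹ • timeFreqShift (-z) r, by
      rw [map_smul, timeFreqShift_timeFreqShift_neg, smul_smul, inv_mul_cancel₀ hc, one_smul]⟩
  rw [hadj]

theorem norm_timeFreqShift_adjoint (z : Phase d) (r : L2 d) :
    ‖(timeFreqShift z).adjoint r‖ = ‖r‖ := by
  rw [← norm_timeFreqShift z, timeFreqShift_adjoint_apply]

theorem norm_parity (r : L2 d) : ‖parity d r‖ = ‖r‖ :=
  (Lp.compMeasurePreservingₗᵢ ℂ (fun t : Space d => -t)
    (Measure.measurePreserving_neg volume)).norm_map r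

theorem parity_parity (r : L2 d) : parity d (parity d r) = r := by
  refine Lp.ext ?_
  have hq := (Measure.measurePreserving_neg (volume : Measure (Space d))).quasiMeasurePreserving
  have h1 := hq.ae_eq_comp (parity_apply_ae r)
  filter_upwards [parity_apply_ae (parity d r), h1] with t h1 h2
  simp only [Function.comp_apply] at h2
  rw [h1, h2, neg_neg]

theorem parity_adjoint : (parity d).adjoint = parity d := by
  have h1 := (ContinuousLinearMap.norm_map_iff_adjoint_comp_self (parity d)).1 norm_parity
  ext1 r
  conv_lhs => rw [← parity_parity r]
  exact congrArg (fun X : L2 d →L[ℂ] L2 d => X (parity d r)) h1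

end BerezinLieb

/-! ### Traces of products -/

namespace BerezinLieb

open scoped ComplexConjugate

section Trace

variable {H : Type*} [NormedAddCommGroup H] [InnerProductSpace ℂ H]

theorem mul_le_sq_add_sq (a b : ℝ) : a * b ≤ a ^ 2 + b ^ 2 := by
  nlinarith [sq_nonneg (a - b), sq_nonneg (a + b)]

theorem summable_norm_sq_comp {ι : Type*} {x : ι → H} (B : H →L[ℂ] H)
    (hx : Summable fun i => ‖x i‖ ^ 2) : Summable fun i => ‖B (x i)‖ ^ 2 := by
  refine Summable.of_nonneg_of_le (fun _ => by positivity) (fun i => ?_) (hx.mul_left (‖B‖ ^ 2))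
  rw [← mul_pow]
  exact pow_le_pow_left₀ (norm_nonneg _) (B.le_opNorm _) 2

theorem summable_prod_norm_inner_sq {ι : Type*} (b : HilbertBasis ι ℂ H) {x : ι → H}
    (hx : Summable fun i => ‖x i‖ ^ 2) :
    Summable fun p : ι × ι => ‖⟪b p.2, x p.1⟫_ℂ‖ ^ 2 := by
  rw [summable_prod_of_nonneg fun p => by positivity]
  refine ⟨fun i => (hasSum_norm_inner_sq b (x i)).summable, ?_⟩
  simp_rw [(hasSum_norm_inner_sq b _).tsum_eq]
  exact hx

variable [CompleteSpace H]

theorem summable_norm_sq_of_adjoint {ι : Type*} (b : HilbertBasis ι ℂ H) {V : H →L[ℂ] H}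
    (hV : Summable fun i => ‖V.adjoint (b i)‖ ^ 2) : Summable fun i => ‖V (b i)‖ ^ 2 := by
  refine (hasSum_norm_sq_of_tsum_enorm_sq (c := ∑' i, ‖V.adjoint (b i)‖ ^ 2)
    (tsum_nonneg fun _ => by positivity) ?_).summable
  rw [← tsum_enorm_adjoint_sq, ENNReal.ofReal_tsum_of_nonneg (fun _ => by positivity) hV]
  simp_rw [ofReal_norm_sq]

/-- Cyclicity of the trace for a product of two Hilbert–Schmidt operators. -/
theorem tsum_inner_eq_tsum_inner_adjoint {ι : Type*} (b : HilbertBasis ι ℂ H) {U V : H →L[ℂ] H}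
    (hU : Summable fun i => ‖U (b i)‖ ^ 2) (hV : Summable fun i => ‖V (b i)‖ ^ 2) :
    ∑' i, ⟪U (b i), V (b i)⟫_ℂ = ∑' j, ⟪V.adjoint (b j), U.adjoint (b j)⟫_ℂ := by
  have hs : Summable (Function.uncurry fun i j => ⟪U (b i), b j⟫_ℂ * ⟪b j, V (b i)⟫_ℂ) := by
    refine Summable.of_norm_bounded ((summable_prod_norm_inner_sq b hU).add
      (summable_prod_norm_inner_sq b hV)) fun p => ?_
    rw [Function.uncurry, norm_mul, norm_inner_symm]
    exact mul_le_sq_add_sq _ _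
  have h1 : ∀ i j, ⟪U (b i), b j⟫_ℂ * ⟪b j, V (b i)⟫_ℂ
      = ⟪V.adjoint (b j), b i⟫_ℂ * ⟪b i, U.adjoint (b j)⟫_ℂ := fun i j => by
    rw [ContinuousLinearMap.adjoint_inner_left, ContinuousLinearMap.adjoint_inner_right, mul_comm]
  calc ∑' i, ⟪U (b i), V (b i)⟫_ℂ = ∑' i, ∑' j, ⟪U (b i), b j⟫_ℂ * ⟪b j, V (b i)⟫_ℂ :=
        tsum_congr fun i => (b.tsum_inner_mul_inner _ _).symm
    _ = ∑' j, ∑' i, ⟪U (b i), b j⟫_ℂ * ⟪b j, V (b i)⟫_ℂ :=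
        (Summable.tsum_comm (f := fun i j => ⟪U (b i), b j⟫_ℂ * ⟪b j, V (b i)⟫_ℂ) hs).symm
    _ = ∑' j, ⟪V.adjoint (b j), U.adjoint (b j)⟫_ℂ :=
        tsum_congr fun j => (tsum_congr fun i => h1 i j).trans (b.tsum_inner_mul_inner _ _)

/-- Cyclicity moves the outer factor around, so that `tr (S X)` with `S = R²` becomes a sum of
quadratic forms in the vectors `R eⱼ`. -/
theorem trace_adjoint_comp {U V : H →L[ℂ] H}
    (hU : Summable fun i => ‖U.adjoint (basis H i)‖ ^ 2)
    (hV : Summable fun i => ‖V.adjoint (basis H i)‖ ^ 2) :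
    trace (U.adjoint ∘L V) = ∑' j, ⟪V.adjoint (basis H j), U.adjoint (basis H j)⟫_ℂ := by
  rw [← tsum_inner_eq_tsum_inner_adjoint _ (summable_norm_sq_of_adjoint _ hU)
    (summable_norm_sq_of_adjoint _ hV)]
  refine tsum_congr fun i => ?_
  rw [ContinuousLinearMap.comp_apply, ContinuousLinearMap.adjoint_inner_right]

theorem inner_im_eq_zero {A : H →L[ℂ] H} (hA : IsSelfAdjoint A) (x : H) : (⟪x, A x⟫_ℂ).im = 0 := by
  rw [← Complex.conj_eq_iff_im, inner_conj_symm, ← ContinuousLinearMap.adjoint_inner_right,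
    ContinuousLinearMap.isSelfAdjoint_iff'.1 hA]

theorem tsum_inner_eq_ofReal {J : Type*} {A : H →L[ℂ] H} (hA : IsSelfAdjoint A) (x : J → H) :
    ∑' j, ⟪x j, A (x j)⟫_ℂ = (∑' j, (⟪x j, A (x j)⟫_ℂ).re : ℝ) := by
  rw [Complex.ofReal_tsum]
  exact tsum_congr fun j => Complex.ext rfl (inner_im_eq_zero hA _)

/-- A positive trace class operator is `R²` for a self-adjoint Hilbert–Schmidt operator `R`. -/
theorem exists_sqrt_of_isTraceClass {S : H →L[ℂ] H} (hS : S.IsPositive) (hS' : IsTraceClass S) :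
    ∃ R : H →L[ℂ] H, R.adjoint = R ∧ R ∘L R = S ∧
      ∑' j, ‖R (basis H j)‖ₑ ^ 2 = ENNReal.ofReal (trace S).re := by
  have h0 : 0 ≤ S := (ContinuousLinearMap.nonneg_iff_isPositive S).2 hS
  obtain ⟨R, hR, hRR, hRS⟩ := exists_sqrt h0
  refine ⟨R, ContinuousLinearMap.isSelfAdjoint_iff'.1 hR, hRR, ?_⟩
  have hfin : posTrace S < ∞ := by
    rwa [IsTraceClass, CFC.abs_of_nonneg S h0] at hS'
  have hnn : ∀ j, 0 ≤ (⟪basis H j, S (basis H j)⟫_ℂ).re := fun j => by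
    simpa using re_inner_mono h0 (basis H j)
  rw [trace, tsum_inner_eq_ofReal (IsSelfAdjoint.of_nonneg h0), Complex.ofReal_re,
    ENNReal.ofReal_tsum_of_nonneg hnn]
  · exact tsum_congr fun j => (hRS _).symm
  · have := ENNReal.summable_toReal hfin.ne
    simpa [ENNReal.toReal_ofReal, hnn] using this

end Trace

/-! ### The resolutions of the identity generated by a state -/

variable {d : ℕ}

instance : TopologicalSpace.SeparableSpace (L2 d) := by
  have : Fact ((2 : ℝ≥0∞) ≠ ∞) := ⟨ENNReal.ofNat_ne_top⟩
  have : SecondCountableTopology (L2 d) := Lp.SecondCountableTopology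
  infer_instance

/-- Needed because the spectrum of an operator on the zero space is empty. -/
theorem IsState.nontrivial {S : L2 d →L[ℂ] L2 d} (hS : IsState S) : Nontrivial (L2 d) := by
  by_contra h
  rw [not_nontrivial_iff_subsingleton] at h
  have h1 : trace S = 0 := by
    refine (tsum_congr fun i => ?_).trans tsum_zero
    rw [Subsingleton.elim (S (basis (L2 d) i)) 0, inner_zero_right]
  exact zero_ne_one (h1.symm.trans hS.trace_eq_one)

/-- A state is `R²` for a self-adjoint Hilbert–Schmidt operator `R`. -/
theorem IsState.exists_sqrt {S : L2 d →L[ℂ] L2 d} (hS : IsState S) :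
    ∃ R : L2 d →L[ℂ] L2 d, R.adjoint = R ∧ R ∘L R = S ∧
      ∑' j, ‖R (basis (L2 d) j)‖ₑ ^ 2 = 1 := by
  obtain ⟨R, hR, hRR, h⟩ := exists_sqrt_of_isTraceClass hS.isPositive hS.isTraceClass
  refine ⟨R, hR, hRR, ?_⟩
  rw [h, hS.trace_eq_one]
  simp

/-- The vectors `π(z) rⱼ` form a resolution of the identity. -/
theorem isResolution_timeFreqShift {J : Type*} [Countable J] {r : J → L2 d}
    (hr : ∑' j, ‖r j‖ₑ ^ 2 = 1) :
    IsResolution volume fun j (z : Phase d) => timeFreqShift z (r j) where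
  measurable j w := measurable_inner_timeFreqShift w (r j)
  tsum_enorm_sq z := by
    simp_rw [← ofReal_norm, norm_timeFreqShift, ofReal_norm, hr]
  lintegral_eq w := by
    rw [lintegral_tsum fun j =>
      ((measurable_inner_timeFreqShift w (r j)).enorm.pow_const 2).aemeasurable]
    simp_rw [lintegral_inner_timeFreqShift_sq]
    rw [ENNReal.tsum_mul_left, hr, mul_one]

/-- Up to conjugation this is again a matrix coefficient of `π(z)`, with the fixed vector and the
test vector exchanged; Moyal's identity is symmetric in them. -/
theorem inner_parity_adjoint (w r : L2 d) (z : Phase d) :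
    ⟪w, parity d ((timeFreqShift z).adjoint r)⟫_ℂ
      = conj ⟪r, timeFreqShift z (parity d w)⟫_ℂ := by
  rw [inner_conj_symm, ← ContinuousLinearMap.adjoint_inner_left, parity_adjoint,
    ContinuousLinearMap.adjoint_inner_right]

/-- The vectors `P π(z)* rⱼ` form a resolution of the identity. -/
theorem isResolution_parity_adjoint {J : Type*} [Countable J] {r : J → L2 d}
    (hr : ∑' j, ‖r j‖ₑ ^ 2 = 1) :
    IsResolution volume fun j (z : Phase d) => parity d ((timeFreqShift z).adjoint (r j)) where
  measurable j w := by
    simp_rw [inner_parity_adjoint]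
    exact Complex.continuous_conj.measurable.comp (measurable_inner_timeFreqShift _ _)
  tsum_enorm_sq z := by
    simp_rw [← ofReal_norm, norm_parity, norm_timeFreqShift_adjoint, ofReal_norm, hr]
  lintegral_eq w := by
    simp_rw [inner_parity_adjoint, RCLike.enorm_conj]
    rw [lintegral_tsum fun j =>
      ((measurable_inner_timeFreqShift (r j) (parity d w)).enorm.pow_const 2).aemeasurable]
    simp_rw [lintegral_inner_timeFreqShift_sq]
    rw [ENNReal.tsum_mul_right, hr, one_mul, ← ofReal_norm, norm_parity, ofReal_norm]

/-- For `X = α_z(Ť)` the product `R² X` splits as `R` times `R X`, both Hilbert–Schmidt, so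
cyclicity gives `∑ⱼ ⟨R eⱼ, X R eⱼ⟩`; the shift and the parity then pass to the vectors. -/
theorem opConv_eq_tsum {R T : L2 d →L[ℂ] L2 d} (hR : R.adjoint = R) (hT : IsSelfAdjoint T)
    (hs : Summable fun j => ‖R (basis (L2 d) j)‖ ^ 2) (z : Phase d) :
    opConv (R ∘L R) T z = ∑' j, ⟪parity d ((timeFreqShift z).adjoint (R (basis (L2 d) j))),
      T (parity d ((timeFreqShift z).adjoint (R (basis (L2 d) j))))⟫_ℂ := by
  have hV : (R ∘L shift z (check T)).adjoint = shift z (check T) ∘L R := by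
    simp only [shift, check, ContinuousLinearMap.adjoint_comp, hR, parity_adjoint,
      ContinuousLinearMap.isSelfAdjoint_iff'.1 hT, ContinuousLinearMap.adjoint_adjoint]
    rfl
  have h := trace_adjoint_comp (U := R) (V := R ∘L shift z (check T)) (by rwa [hR])
    (by rw [hV]; exact summable_norm_sq_comp (shift z (check T)) hs)
  rw [hR, hV] at h
  rw [opConv]
  refine h.trans (tsum_congr fun j => ?_)
  simp only [shift, check, ContinuousLinearMap.comp_apply]
  rw [← ContinuousLinearMap.adjoint_inner_right, ← ContinuousLinearMap.adjoint_inner_right,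
    parity_adjoint, ← ContinuousLinearMap.adjoint_inner_right,
    ContinuousLinearMap.isSelfAdjoint_iff'.1 hT]

theorem husimi_eq_tsum {R A : L2 d →L[ℂ] L2 d} (hR : R.adjoint = R)
    (hs : Summable fun j => ‖R (basis (L2 d) j)‖ ^ 2) (z : Phase d) :
    husimi (R ∘L R) A z = ∑' j, ⟪timeFreqShift z (R (basis (L2 d) j)),
      A (timeFreqShift z (R (basis (L2 d) j)))⟫_ℂ := by
  have h := trace_adjoint_comp (U := (A ∘L timeFreqShift z ∘L R).adjoint)
    (V := (timeFreqShift z ∘L R).adjoint)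
    (by
      rw [ContinuousLinearMap.adjoint_adjoint]
      exact summable_norm_sq_comp (A ∘L timeFreqShift z) hs)
    (by
      rw [ContinuousLinearMap.adjoint_adjoint]
      exact summable_norm_sq_comp (timeFreqShift z) hs)
  rw [ContinuousLinearMap.adjoint_adjoint, ContinuousLinearMap.adjoint_adjoint,
    ContinuousLinearMap.adjoint_comp, hR] at h
  exact h

end BerezinLieb

/-! ### Weak integrals of rank-one resolutions -/

namespace BerezinLieb

open scoped ComplexConjugate

section WeakIntegral

variable {H : Type*} [NormedAddCommGroup H] [InnerProductSpace ℂ H]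
variable {Z J : Type*} [MeasurableSpace Z] {μ : Measure Z} {v : J → Z → H} {K : Z → H →L[ℂ] H}

theorem IsResolution.norm_inner_le (hv : IsResolution μ v)
    (hK : ∀ z η ψ, HasSum (fun j => ⟪η, v j z⟫_ℂ * ⟪v j z, ψ⟫_ℂ) ⟪η, K z ψ⟫_ℂ) (η ψ : H) (z : Z) :
    ‖⟪η, K z ψ⟫_ℂ‖ ≤ ∑' j, ‖⟪η, v j z⟫_ℂ‖ ^ 2 + ∑' j, ‖⟪ψ, v j z⟫_ℂ‖ ^ 2 := by
  rw [← (hK z η ψ).tsum_eq,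
    ← (hv.summable_norm_inner_sq η z).tsum_add (hv.summable_norm_inner_sq ψ z)]
  refine tsum_of_norm_bounded
    ((hv.summable_norm_inner_sq η z).add (hv.summable_norm_inner_sq ψ z)).hasSum fun j => ?_
  rw [norm_mul, norm_inner_symm (v j z)]
  exact mul_le_sq_add_sq _ _

theorem IsResolution.measurable_inner [Countable J] (hv : IsResolution μ v)
    (hK : ∀ z η ψ, HasSum (fun j => ⟪η, v j z⟫_ℂ * ⟪v j z, ψ⟫_ℂ) ⟪η, K z ψ⟫_ℂ) (η ψ : H) :
    Measurable fun z => ⟪η, K z ψ⟫_ℂ := by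
  simp_rw [← (hK _ η ψ).tsum_eq]
  refine Measurable.tsum fun j => (hv.measurable j η).mul ?_
  simp_rw [← inner_conj_symm (v j _) ψ]
  exact Complex.continuous_conj.measurable.comp (hv.measurable j ψ)

theorem IsResolution.integrable_mul_inner [Countable J] (hv : IsResolution μ v)
    (hK : ∀ z η ψ, HasSum (fun j => ⟪η, v j z⟫_ℂ * ⟪v j z, ψ⟫_ℂ) ⟪η, K z ψ⟫_ℂ) {f : Z → ℂ} {C : ℝ}
    (hf : AEStronglyMeasurable f μ) (hC : ∀ᵐ z ∂μ, ‖f z‖ ≤ C) (η ψ : H) :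
    Integrable (fun z => f z * ⟪η, K z ψ⟫_ℂ) μ := by
  refine (((hv.integrable_tsum η).add (hv.integrable_tsum ψ)).const_mul C).mono'
    (hf.mul (hv.measurable_inner hK η ψ).aestronglyMeasurable) ?_
  filter_upwards [hC] with z hz
  rw [norm_mul]
  exact mul_le_mul hz (hv.norm_inner_le hK η ψ z) (norm_nonneg _) ((norm_nonneg _).trans hz)

theorem IsResolution.norm_integral_le [Countable J] (hv : IsResolution μ v)
    (hK : ∀ z η ψ, HasSum (fun j => ⟪η, v j z⟫_ℂ * ⟪v j z, ψ⟫_ℂ) ⟪η, K z ψ⟫_ℂ) {f : Z → ℂ} {C : ℝ}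
    (hC : ∀ᵐ z ∂μ, ‖f z‖ ≤ C) (η ψ : H) :
    ‖∫ z, f z * ⟪η, K z ψ⟫_ℂ ∂μ‖ ≤ C * (‖η‖ ^ 2 + ‖ψ‖ ^ 2) := by
  rw [← hv.integral_tsum η, ← hv.integral_tsum ψ,
    ← integral_add (hv.integrable_tsum η) (hv.integrable_tsum ψ), ← integral_const_mul]
  refine norm_integral_le_of_norm_le
    (((hv.integrable_tsum η).add (hv.integrable_tsum ψ)).const_mul C) ?_
  filter_upwards [hC] with z hz
  rw [norm_mul]
  exact mul_le_mul hz (hv.norm_inner_le hK η ψ z) (norm_nonneg _) ((norm_nonneg _).trans hz)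

/-- Rescaling both arguments to unit vectors turns the additive bound into a multiplicative one. -/
theorem norm_sesq_le {B : H →ₗ⋆[ℂ] H →ₗ[ℂ] ℂ} {C : ℝ}
    (hB : ∀ x y, ‖B x y‖ ≤ C * (‖x‖ ^ 2 + ‖y‖ ^ 2)) (x y : H) :
    ‖B x y‖ ≤ 2 * C * ‖x‖ * ‖y‖ := by
  rcases eq_or_ne x 0 with rfl | hx
  · simp
  rcases eq_or_ne y 0 with rfl | hy
  · simp
  have hx' := norm_pos_iff.2 hx
  have hy' := norm_pos_iff.2 hy
  have h := hB (((‖x‖⁻¹ : ℝ) : ℂ) • x) (((‖y‖⁻¹ : ℝ) : ℂ) • y)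
  rw [LinearMap.map_smulₛₗ₂, map_smul, norm_smul, norm_smul, norm_smul,
    norm_smul, RCLike.norm_conj, Complex.norm_real, Complex.norm_real, norm_inv, norm_norm,
    norm_inv, norm_norm, inv_mul_cancel₀ hx'.ne', inv_mul_cancel₀ hy'.ne', ← mul_assoc, ← mul_inv,
    inv_mul_le_iff₀ (mul_pos hx' hy')] at h
  linarith

variable [CompleteSpace H]

/-- Existence of the weak integral `∫ f(z) K(z) dz`. -/
theorem IsResolution.exists_weakIntegral [Countable J] (hv : IsResolution μ v)
    (hK : ∀ z η ψ, HasSum (fun j => ⟪η, v j z⟫_ℂ * ⟪v j z, ψ⟫_ℂ) ⟪η, K z ψ⟫_ℂ) {f : Z → ℂ} {C : ℝ}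
    (hf : AEStronglyMeasurable f μ) (hC : ∀ᵐ z ∂μ, ‖f z‖ ≤ C) :
    ∃ A : H →L[ℂ] H, ∀ ψ η, ⟪η, A ψ⟫_ℂ = ∫ z, f z * ⟪η, K z ψ⟫_ℂ ∂μ := by
  have hint := hv.integrable_mul_inner hK hf hC
  let B : H →ₗ⋆[ℂ] H →ₗ[ℂ] ℂ := LinearMap.mk₂'ₛₗ (starRingEnd ℂ) (RingHom.id ℂ)
    (fun η ψ => ∫ z, f z * ⟪η, K z ψ⟫_ℂ ∂μ)
    (fun η₁ η₂ ψ => by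
      rw [← integral_add (hint _ _) (hint _ _)]
      simp_rw [inner_add_left, mul_add])
    (fun c η ψ => by
      rw [smul_eq_mul, ← integral_const_mul]
      simp_rw [inner_smul_left, mul_left_comm])
    (fun η ψ₁ ψ₂ => by
      rw [← integral_add (hint _ _) (hint _ _)]
      simp_rw [map_add, inner_add_right, mul_add])
    (fun c η ψ => by
      rw [smul_eq_mul, RingHom.id_apply, ← integral_const_mul]
      simp_rw [map_smul, inner_smul_right, mul_left_comm])
  have hB : ∀ η ψ, B η ψ = ∫ z, f z * ⟪η, K z ψ⟫_ℂ ∂μ := fun η ψ => rfl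
  have hbound : ∀ η ψ, ‖B η ψ‖ ≤ 2 * C * ‖η‖ * ‖ψ‖ :=
    norm_sesq_le fun η ψ => by rw [hB]; exact hv.norm_integral_le hK hC η ψ
  -- The operator attached to a sesquilinear form represents it through the first slot, `⟪X η, ψ⟫ =
  -- B η ψ`, hence the adjoint.
  refine ⟨(InnerProductSpace.continuousLinearMapOfBilin (B.mkContinuous₂ (2 * C) hbound)).adjoint,
    fun ψ η => ?_⟩
  rw [ContinuousLinearMap.adjoint_inner_right, InnerProductSpace.continuousLinearMapOfBilin_apply,
    LinearMap.mkContinuous₂_apply, hB]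

theorem isSelfAdjoint_of_weakIntegral {f : Z → ℝ} {A : H →L[ℂ] H}
    (hK : ∀ z, IsSelfAdjoint (K z))
    (hA : ∀ ψ η, ⟪η, A ψ⟫_ℂ = ∫ z, (f z : ℂ) * ⟪η, K z ψ⟫_ℂ ∂μ) : IsSelfAdjoint A := by
  rw [ContinuousLinearMap.isSelfAdjoint_iff']
  refine ContinuousLinearMap.ext fun ψ => ext_inner_left ℂ fun η => ?_
  rw [ContinuousLinearMap.adjoint_inner_right, ← inner_conj_symm, hA, hA, ← integral_conj]
  refine integral_congr_ae (ae_of_all _ fun z => ?_)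
  simp only [map_mul, Complex.conj_ofReal, inner_conj_symm]
  rw [← ContinuousLinearMap.adjoint_inner_right, ContinuousLinearMap.isSelfAdjoint_iff'.1 (hK z)]

end WeakIntegral

/-! ### The essential range -/

section EssRange

variable {X : Type*} [MeasureSpace X] {f : X → ℝ}

theorem isClosed_essRange : IsClosed (essRange f) := by
  rw [← isOpen_compl_iff, Metric.isOpen_iff]
  intro y hy
  simp only [essRange, Set.mem_compl_iff, Set.mem_ofPred_eq, not_forall, not_not] at hy
  obtain ⟨ε, hε, h0⟩ := hy
  refine ⟨ε / 2, half_pos hε, fun y' hy' hmem => hmem (ε / 2) (half_pos hε) ?_⟩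
  refine measure_mono_null (fun x hx => ?_) h0
  rw [Metric.mem_ball, Real.dist_eq] at hy'
  have hx : |f x - y'| < ε / 2 := hx
  calc |f x - y| ≤ |f x - y'| + |y' - y| := abs_sub_le _ _ _
    _ < ε := by linarith

theorem isCompact_essRange {C : ℝ} (hC : ∀ᵐ x, ‖f x‖ ≤ C) : IsCompact (essRange f) := by
  refine (isCompact_Icc (a := -C) (b := C)).of_isClosed_subset isClosed_essRange fun y hy => ?_
  rw [Set.mem_Icc, ← abs_le]
  by_contra! h
  refine hy (|y| - C) (sub_pos.2 h) (measure_mono_null (fun x hx => ?_) hC)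
  have hx : |f x - y| < |y| - C := hx
  change ¬ ‖f x‖ ≤ C
  rw [Real.norm_eq_abs, not_le]
  have := abs_sub_abs_le_abs_sub y (f x)
  rw [abs_sub_comm] at this
  linarith

/-- Every point outside the essential range has a ball with null preimage, and countably many such
balls cover the complement. -/
theorem ae_mem_essRange (hf : AEMeasurable f) : ∀ᵐ x, f x ∈ essRange f := by
  refine ae_of_ae_map hf ?_
  change Measure.map f volume (essRange f)ᶜ = 0
  refine measure_null_of_locally_null _ fun y hy => ?_
  simp only [essRange, Set.mem_compl_iff, Set.mem_ofPred_eq, not_forall, not_not] at hy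
  obtain ⟨ε, hε, h0⟩ := hy
  refine ⟨Metric.ball y ε, mem_nhdsWithin_of_mem_nhds (Metric.ball_mem_nhds y hε), ?_⟩
  rw [Measure.map_apply_of_aemeasurable hf measurableSet_ball]
  exact h0

end EssRange

/-! ### Convolutions with a state -/

variable {d : ℕ}

/-- Parseval's identity for the vectors `R π(z)* η` and `R π(z)* ψ`; it exhibits `α_z(R²)` as `∑ⱼ
|vⱼ(z)⟩⟨vⱼ(z)|`. -/
theorem hasSum_inner_shift {R : L2 d →L[ℂ] L2 d} (hR : R.adjoint = R) (z : Phase d) (η ψ : L2 d) :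
    HasSum (fun j => ⟪η, timeFreqShift z (R (basis (L2 d) j))⟫_ℂ
      * ⟪timeFreqShift z (R (basis (L2 d) j)), ψ⟫_ℂ) ⟪η, shift z (R ∘L R) ψ⟫_ℂ := by
  have h := (basis (L2 d)).hasSum_inner_mul_inner (R ((timeFreqShift z).adjoint η))
    (R ((timeFreqShift z).adjoint ψ))
  have hsymm : ∀ x y, ⟪R x, y⟫_ℂ = ⟪x, R y⟫_ℂ := fun x y => by
    rw [← ContinuousLinearMap.adjoint_inner_right, hR]
  convert! h using 1
  · ext j
    rw [hsymm, ContinuousLinearMap.adjoint_inner_left, ← hsymm (basis (L2 d) j),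
      ContinuousLinearMap.adjoint_inner_right]
  · rw [hsymm, ContinuousLinearMap.adjoint_inner_left]
    rfl

theorem isSelfAdjoint_shift (z : Phase d) {S : L2 d →L[ℂ] L2 d} (hS : IsSelfAdjoint S) :
    IsSelfAdjoint (shift z S) := by
  rw [ContinuousLinearMap.isSelfAdjoint_iff', shift, ContinuousLinearMap.adjoint_comp,
    ContinuousLinearMap.adjoint_comp, ContinuousLinearMap.adjoint_adjoint,
    ContinuousLinearMap.isSelfAdjoint_iff'.1 hS]
  rfl

theorem exists_ae_norm_le {f : Phase d → ℝ} (hf : MemLp f ∞ volume) : ∃ C, ∀ᵐ z, ‖f z‖ ≤ C := by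
  refine ⟨(eLpNorm f ∞ volume).toReal, ?_⟩
  filter_upwards [ae_le_eLpNormEssSup (f := f) (μ := volume)] with z hz
  rw [← eLpNorm_exponent_top] at hz
  rw [← toReal_enorm]
  exact ENNReal.toReal_mono hf.2.ne hz

theorem isFunConv_funConv {S : L2 d →L[ℂ] L2 d} {f : Phase d → ℝ} (hS : IsState S)
    (hf : MemLp f ∞ volume) :
    IsFunConv (fun z => (f z : ℂ)) S (funConv (fun z => (f z : ℂ)) S) := by
  have hex : ∃ A, IsFunConv (fun z => (f z : ℂ)) S A := by
    obtain ⟨R, hR, rfl, hr⟩ := hS.exists_sqrt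
    obtain ⟨C, hC⟩ := exists_ae_norm_le hf
    have hC' : ∀ᵐ z, ‖(f z : ℂ)‖ ≤ C := by simpa using hC
    have hm : AEStronglyMeasurable (fun z => (f z : ℂ)) volume :=
      Complex.continuous_ofReal.comp_aestronglyMeasurable hf.1
    have hv := isResolution_timeFreqShift hr
    obtain ⟨A, hA⟩ := hv.exists_weakIntegral (hasSum_inner_shift hR) hm hC'
    exact ⟨A, fun ψ η => ⟨hv.integrable_mul_inner (hasSum_inner_shift hR) hm hC' η ψ, hA ψ η⟩⟩
  rw [funConv, dif_pos hex]
  exact hex.choose_spec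

theorem isSelfAdjoint_funConv {S : L2 d →L[ℂ] L2 d} {f : Phase d → ℝ} (hS : IsState S)
    (hf : MemLp f ∞ volume) : IsSelfAdjoint (funConv (fun z => (f z : ℂ)) S) :=
  isSelfAdjoint_of_weakIntegral (fun z => isSelfAdjoint_shift z hS.isPositive.isSelfAdjoint)
    fun ψ η => (isFunConv_funConv hS hf ψ η).2

theorem posTrace_applyFun_funConv_le {S : L2 d →L[ℂ] L2 d} {f : Phase d → ℝ} (hS : IsState S)
    (hf : MemLp f ∞ volume) {D : Set ℝ} {Φ : ℝ → ℝ} (hΦ : ConvexOn ℝ D Φ)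
    (hcont : ContinuousOn Φ D) (hpos : ∀ t ∈ D, 0 ≤ Φ t) (hfD : essRange f ⊆ D)
    (hAD : realSpectrum (funConv (fun z => (f z : ℂ)) S) ⊆ D) :
    posTrace (applyFun Φ (funConv (fun z => (f z : ℂ)) S)) ≤ ∫⁻ z, ENNReal.ofReal (Φ (f z)) := by
  have := hS.nontrivial
  have hA := isSelfAdjoint_funConv hS hf
  have hw := isFunConv_funConv hS hf
  obtain ⟨C, hC⟩ := exists_ae_norm_le hf
  obtain ⟨R, hR, hRR, hr⟩ := hS.exists_sqrt
  have hv := isResolution_timeFreqShift hr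
  have hq : ∀ w z, ⟪w, shift z S w⟫_ℂ
      = ((∑' j, ‖⟪w, timeFreqShift z (R (basis (L2 d) j))⟫_ℂ‖ ^ 2 : ℝ) : ℂ) := fun w z => by
    rw [← hRR, ← (hasSum_inner_shift hR z w w).tsum_eq, Complex.ofReal_tsum]
    refine tsum_congr fun j => ?_
    rw [← inner_conj_symm _ w, Complex.mul_conj']
    push_cast
    rfl
  have hint : ∀ w, Integrable fun z =>
      f z * ∑' j, ‖⟪w, timeFreqShift z (R (basis (L2 d) j))⟫_ℂ‖ ^ 2 := fun w => by
    have := (hw w w).1.re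
    simp_rw [hq, ← Complex.ofReal_mul] at this
    exact this
  refine hv.posTrace_le_lintegral_comp hf.1.aemeasurable hA hint (fun w => ?_)
    (isCompact_essRange hC) hfD (ae_mem_essRange hf.1.aemeasurable) hΦ hcont hpos hAD
  rw [(hw w w).2]
  simp_rw [hq, ← Complex.ofReal_mul]
  rw [integral_complex_ofReal, Complex.ofReal_re]

theorem lintegral_comp_opConv_le {S T : L2 d →L[ℂ] L2 d} (hS : IsState S) (hT : IsSelfAdjoint T)
    {D : Set ℝ} {Φ : ℝ → ℝ} (hΦ : ConvexOn ℝ D Φ) (hcont : ContinuousOn Φ D)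
    (hpos : ∀ t ∈ D, 0 ≤ Φ t) (hTD : realSpectrum T ⊆ D) :
    ∫⁻ z, ENNReal.ofReal (Φ (opConv S T z).re) ≤ posTrace (applyFun Φ T) := by
  have := hS.nontrivial
  obtain ⟨R, hR, rfl, hr⟩ := hS.exists_sqrt
  have hs := (hasSum_norm_sq_of_tsum_enorm_sq zero_le_one
    (hr.trans ENNReal.ofReal_one.symm)).summable
  simp_rw [opConv_eq_tsum hR hT hs, tsum_inner_eq_ofReal hT, Complex.ofReal_re]
  exact (isResolution_parity_adjoint hr).lintegral_comp_le_posTrace hT hΦ hcont hpos hTD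

theorem lintegral_comp_husimi_le {S T : L2 d →L[ℂ] L2 d} (hS : IsState S) (hT : IsSelfAdjoint T)
    {D : Set ℝ} {Φ : ℝ → ℝ} (hΦ : ConvexOn ℝ D Φ) (hcont : ContinuousOn Φ D)
    (hpos : ∀ t ∈ D, 0 ≤ Φ t) (hTD : realSpectrum T ⊆ D) :
    ∫⁻ z, ENNReal.ofReal (Φ (husimi S T z).re) ≤ posTrace (applyFun Φ T) := by
  have := hS.nontrivial
  obtain ⟨R, hR, rfl, hr⟩ := hS.exists_sqrt
  have hs := (hasSum_norm_sq_of_tsum_enorm_sq zero_le_one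
    (hr.trans ENNReal.ofReal_one.symm)).summable
  simp_rw [husimi_eq_tsum hR hs, tsum_inner_eq_ofReal hT, Complex.ofReal_re]
  exact (isResolution_timeFreqShift hr).lintegral_comp_le_posTrace hT hΦ hcont hpos hTD

theorem opConv_im {S T : L2 d →L[ℂ] L2 d} (hS : IsState S) (hT : IsSelfAdjoint T) (z : Phase d) :
    (opConv S T z).im = 0 := by
  obtain ⟨R, hR, rfl, hr⟩ := hS.exists_sqrt
  have hs := (hasSum_norm_sq_of_tsum_enorm_sq zero_le_one
    (hr.trans ENNReal.ofReal_one.symm)).summable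
  rw [opConv_eq_tsum hR hT hs, tsum_inner_eq_ofReal hT, Complex.ofReal_im]

theorem husimi_im {S T : L2 d →L[ℂ] L2 d} (hS : IsState S) (hT : IsSelfAdjoint T) (z : Phase d) :
    (husimi S T z).im = 0 := by
  obtain ⟨R, hR, rfl, hr⟩ := hS.exists_sqrt
  have hs := (hasSum_norm_sq_of_tsum_enorm_sq zero_le_one
    (hr.trans ENNReal.ofReal_one.symm)).summable
  rw [husimi_eq_tsum hR hs, tsum_inner_eq_ofReal hT, Complex.ofReal_im]

theorem convexOn_exp_mul (c : ℝ) : ConvexOn ℝ Set.univ fun t => Real.exp (c * t) := by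
  simpa [Function.comp_def] using! convexOn_exp.comp_linearMap (c • LinearMap.id)

end BerezinLieb

theorem proposition4p2 (d : ℕ) :
    -- the inequality for operators
    (∀ S T : L2 d →L[ℂ] L2 d, IsState S → IsSelfAdjoint T →
      (∀ z, (opConv S T z).im = 0) ∧
      ∀ (D : Set ℝ) (Φ : ℝ → ℝ),
        ConvexOn ℝ D Φ → ContinuousOn Φ D → (∀ t ∈ D, 0 ≤ Φ t) →
        realSpectrum T ⊆ D → essRange (fun z => (opConv S T z).re) ⊆ D →
        ∫⁻ z, ENNReal.ofReal (Φ (opConv S T z).re) ≤ posTrace (applyFun Φ T)) ∧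
    -- the inequality for functions
    (∀ (S : L2 d →L[ℂ] L2 d) (f : Phase d → ℝ), IsState S → MemLp f ∞ volume →
      IsFunConv (fun z => (f z : ℂ)) S (funConv (fun z => (f z : ℂ)) S) ∧
      IsSelfAdjoint (funConv (fun z => (f z : ℂ)) S) ∧
      ∀ (D : Set ℝ) (Φ : ℝ → ℝ),
        ConvexOn ℝ D Φ → ContinuousOn Φ D → (∀ t ∈ D, 0 ≤ Φ t) →
        essRange f ⊆ D → realSpectrum (funConv (fun z => (f z : ℂ)) S) ⊆ D →
        posTrace (applyFun Φ (funConv (fun z => (f z : ℂ)) S))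
          ≤ ∫⁻ z, ENNReal.ofReal (Φ (f z))) ∧
    -- the exponential function and the generalized phase space representations of `A`
    (∀ (A : L2 d →L[ℂ] L2 d) (β : ℝ), IsSelfAdjoint A →
      (∀ σ' : L2 d →L[ℂ] L2 d, IsState σ' →
        (∀ z, (husimi σ' A z).im = 0) ∧
        ∫⁻ z, ENNReal.ofReal (Real.exp (-β * (husimi σ' A z).re))
          ≤ posTrace (applyFun (fun t => Real.exp (-β * t)) A)) ∧
      (∀ (σ : L2 d →L[ℂ] L2 d) (f : Phase d → ℝ), IsState σ → MemLp f ∞ volume →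
        A = funConv (fun z => (f z : ℂ)) σ.adjoint →
        posTrace (applyFun (fun t => Real.exp (-β * t)) A)
          ≤ ∫⁻ z, ENNReal.ofReal (Real.exp (-β * f z)))) := by
  refine ⟨fun S T hS hT => ⟨opConv_im hS hT, fun D Φ hΦ hcont hpos hTD _ =>
      lintegral_comp_opConv_le hS hT hΦ hcont hpos hTD⟩,
    fun S f hS hf => ⟨isFunConv_funConv hS hf, isSelfAdjoint_funConv hS hf,
      fun D Φ hΦ hcont hpos hfD hAD => posTrace_applyFun_funConv_le hS hf hΦ hcont hpos hfD hAD⟩,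
    fun A β hA => ⟨fun σ hσ => ⟨husimi_im hσ hA, ?_⟩, ?_⟩⟩
  · exact lintegral_comp_husimi_le hσ hA (convexOn_exp_mul (-β)) (by fun_prop)
      (fun t _ => (Real.exp_pos _).le) (Set.subset_univ _)
  · rintro σ f hσ hf rfl
    -- A state is self-adjoint, so `σ*` is `σ` itself.
    rw [ContinuousLinearMap.isSelfAdjoint_iff'.1 hσ.isPositive.isSelfAdjoint]
    exact posTrace_applyFun_funConv_le hσ hf (convexOn_exp_mul (-β)) (by fun_prop)
      (fun t _ => (Real.exp_pos _).le) (Set.subset_univ _) (Set.subset_univ _)
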